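/- A *plane map* is an embedding in the plane (a drawing without crossings) of a finite multigraph without loops (parallel edges are allowed, and the multigraph need not be connected) such that each face has length at least $3$; here the length of a face is the number of edges on its boundary, an edge counting twice if both of its sides lie on that face. For a vertex $v$ let $N(v)$ be its set of neighbours, let $d_H(v)$ be the number of edges of $H$ incident with $v$ (parallel edges are counted separately), and for $D\subseteq V(H)$ let $H[D]$ be the submultigraph of $H$ induced by $D$. Let $H$ be a plane map and let $A$, $C$, $D$ be pairwise disjoint vertex sets with $V(H)=A\cup C\cup D$ such that: - $A$ is an independent set and $d_H(v)\ge 3$ for every $v\in A$; - $|N(v)\cap D|\ge 2$ for every $v\in C$; - for all distinct $v_1,v_2\in C$ with $|N(v_1)\cap D|=|N(v_2)\cap D|=2$, we have $N(v_1)\cap D\neq N(v_2)\cap D$. Then there exists $u\in D$ with $d_{H[D]}(u)\le 10$ and $d_H(u)\le 40$. -/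

import Mathlib

namespace Graph

/-- The degree of a vertex of a multigraph without loops: the number of edges incident with it,
so that parallel edges are counted with multiplicity. -/
noncomputable def degree {α β : Type*} (H : Graph α β) (x : α) : ℕ := (H.incidenceSet x).ncard

/-- The neighborhood `N(x)`, a set of vertices (multiplicities are forgotten). -/
def neighborhood {α β : Type*} (H : Graph α β) (x : α) : Set α := {y | H.Adj x y}

/-- No edge joins two vertices of `A`. -/
def IsIndependent {α β : Type*} (H : Graph α β) (A : Set α) : Prop :=
  ∀ x ∈ A, ∀ y ∈ A, ¬ H.Adj x y

/-- `y` can be reached from `x` along edges (always true for `x = y`). -/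
def Reaches {α β : Type*} (H : Graph α β) (x y : α) : Prop := Relation.ReflTransGen H.Adj x y

/-- The vertex sets of the connected components. -/
def components {α β : Type*} (H : Graph α β) : Set (Set α) :=
  {S | ∃ x ∈ V(H), S = {y | H.Reaches x y}}

/-- An isolated vertex: a vertex incident with no edge. -/
def IsIsolated {α β : Type*} (H : Graph α β) (x : α) : Prop := x ∈ V(H) ∧ ∀ e, ¬ H.Inc e x

/-- A dart (half-edge) of a multigraph without loops: an edge together with one of its two ends.
It is thought of as the edge directed away from `vertex`. -/
@[ext]
structure Dart {α β : Type*} (H : Graph α β) where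
  edge : β
  vertex : α
  inc : H.Inc edge vertex

/-- An embedding in the plane (equivalently, in the oriented sphere) of a finite multigraph `H`
without loops, with set of faces `F`, given combinatorially by a rotation system together with the
faces. `H` need not be connected.

`rot` is the rotation system: it sends each dart to the next dart around the same vertex, in
clockwise order. Walking along a dart `d` to its other end and leaving that end by the dart
that is next after the reverse of `d` follows the boundary of the face to the left of `d`. This
face is `face d`. An isolated vertex lies in the face `isolatedFace`. Several boundary walks
(of different components) may belong to one face.

Gluing the faces to `H` along these boundary walks gives a closed surface if every walk bounds its
own disc, and in general a union of such surfaces glued by discs with holes. If it is connected and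
`H` has `c` components, then `|V| - |E| + |F| ≤ 1 + c`, and equality holds exactly when each
component has genus zero and the incidences of components with faces (one for each boundary
walk) form a tree, that is, when the surface is the sphere. -/
structure PlaneEmbedding {α β : Type*} (H : Graph α β) (F : Type*) where
  rot : Equiv.Perm H.Dart
  /-- The rotation stays at the vertex, and -/
  rot_vertex : ∀ d, (rot d).vertex = d.vertex
  /-- it permutes the darts at each vertex in a single cycle. -/
  rot_sameCycle : ∀ d d' : H.Dart, d.vertex = d'.vertex → rot.SameCycle d d'
  /-- The face on the left of a dart. -/
  face : H.Dart → F
  /-- The face is constant along boundary walks; here `d'` is the reverse of `d`. -/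
  face_rot : ∀ d d' : H.Dart, d.edge = d'.edge → d.vertex ≠ d'.vertex → face (rot d') = face d
  /-- The face in which an isolated vertex lies. -/
  isolatedFace : {x // H.IsIsolated x} → F
  finite_face : Finite F
  nonempty_face : Nonempty F
  /-- The surface is connected: any two faces are linked by a chain of faces in which consecutive
  faces are incident with the same component of `H`. -/
  connected : ∀ f g : F, Relation.ReflTransGen
    (fun f g : F => ∃ x y : α,
      ((∃ d : H.Dart, d.vertex = x ∧ face d = f) ∨ ∃ h : H.IsIsolated x, isolatedFace ⟨x, h⟩ = f) ∧
      H.Reaches x y ∧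
      ((∃ d : H.Dart, d.vertex = y ∧ face d = g) ∨ ∃ h : H.IsIsolated y, isolatedFace ⟨y, h⟩ = g))
    f g
  /-- The surface has genus zero: `|V| - |E| + |F| = 1 + c`. -/
  genus_zero : V(H).ncard + Nat.card F = E(H).ncard + 1 + H.components.ncard

/-- The length of a face: the number of edges on its boundary, an edge counting twice if both of its
sides are on the face. -/
noncomputable def PlaneEmbedding.faceLength {α β F : Type*} {H : Graph α β}
    (M : H.PlaneEmbedding F) (f : F) : ℕ :=
  Nat.card {d : H.Dart // M.face d = f}

/-- A plane map: a plane embedding in which each face has length at least 3. -/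
def PlaneEmbedding.IsPlaneMap {α β F : Type*} {H : Graph α β} (M : H.PlaneEmbedding F) : Prop :=
  ∀ f : F, 3 ≤ M.faceLength f

end Graph

section

open Finset Classical

/-! Suppose every `u ∈ D` has at least 11 darts to `D` or at least 41 darts in all. Chords between
vertices that are distinct, not both in `A`, and at distance two along a face of length at least 4
can be drawn without losing any hypothesis. The number of darts is bounded, so this stops at a
saturated map (`false_of_saturated`), where every corner whose two targets are distinct and not both
in `A` lies in a triangle (`Saturated.σ_r_φ`).

The rest is discharging. Euler's formula gives `6|V| ≥ |X| + Σ(2 len f - 6) + 6`. A vertex of `C`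
with `d ≥ 3` darts to `D` satisfies `6 ≤ 2d`; one with `d = 2` (class `C2`) is two units short and
borrows one from each of its two darts to `D`. What remains is that `6|D|` plus the number of darts
from `D` to `C2` exceeds the number of `D`-`D` darts, plus that of `C`-`C` darts, plus the excesses
`2 deg - 6` over `A` and `2 len - 6` over the faces.

The reverse inequality is proved locally at each `u ∈ D` (`charge_le`). A side of a dart from `u` to
a `C2`-vertex `v` is good if, up to one dart to `A`, the next dart on that side leads to the other
`D`-neighbour of `v`. Since `C2`-vertices have distinct `D`-neighbourhoods, good sides are at most
as many as `D`-`D` darts at `u` (`card_good_le`). The defects are paid elsewhere: bad sides by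
vertices of `A` and edges inside `C` (`Saturated.card_bad_le`, `card_CC_ge`); `A`-`A` corners and
consecutive `C3`-vertices by large faces, `C3`-`C3` edges and vertices of `A`
(`Saturated.card_events_le`, `Saturated.card_le_sum_A`). -/

/-- The three classes of vertices. -/
inductive VertexKind
  | A
  | C
  | D

/-! ### Combinatorial maps and their rotations -/

/-- A combinatorial map with set of darts `X`, on the vertex set `V`, whose vertices are divided
into three classes. The permutation `σ` is the rotation system, `r` reverses a dart, `s` is the
source of a dart. The faces need not be bounded by single walks. -/
structure ColouredMap (V X F : Type*) [Fintype V] [Fintype X] [Fintype F] where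
  kind : V → VertexKind
  σ : Equiv.Perm X
  r : X → X
  s : X → V
  face : X → F
  r_r : ∀ x, r (r x) = x
  s_r : ∀ x, s (r x) ≠ s x
  s_σ : ∀ x, s (σ x) = s x
  sameCycle : ∀ x y, s x = s y → σ.SameCycle x y
  face_σ_r : ∀ x, face (σ (r x)) = face x
  three_le_face : ∀ f, 3 ≤ #{x | face x = f}
  euler : Fintype.card X + 2 ≤ 2 * Fintype.card V + 2 * Fintype.card F
  indep : ∀ x, kind (s x) = .A → kind (s (r x)) ≠ .A
  three_le_deg : ∀ v, kind v = .A → 3 ≤ #{x | s x = v}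
  two_le_nbr : ∀ v, kind v = .C → 2 ≤ #{w | kind w = .D ∧ ∃ x, s x = v ∧ s (r x) = w}
  nbr_inj : ∀ v₁ v₂, kind v₁ = .C → kind v₂ = .C →
    #{w | kind w = .D ∧ ∃ x, s x = v₁ ∧ s (r x) = w} = 2 →
    {w | kind w = .D ∧ ∃ x, s x = v₁ ∧ s (r x) = w} =
      {w | kind w = .D ∧ ∃ x, s x = v₂ ∧ s (r x) = w} → v₁ = v₂
  deg_D : ∀ u, kind u = .D → 11 ≤ #{x | s x = u ∧ kind (s (r x)) = .D} ∨ 41 ≤ #{x | s x = u}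

namespace ColouredMap

variable {V X F : Type*} [Fintype V] [Fintype X] [Fintype F] (M : ColouredMap V X F)

/-- The target of a dart. -/
def t (x : X) : V := M.s (M.r x)

/-- The degree of a vertex. -/
noncomputable def deg (v : V) : ℕ := #{x | M.s x = v}

/-- The number of darts on the boundary of a face. -/
noncomputable def len (f : F) : ℕ := #{x | M.face x = f}

/-- The neighbours of `v` in the class `D`. -/
noncomputable def nbr (v : V) : Finset V := {w | M.kind w = .D ∧ ∃ x, M.s x = v ∧ M.s (M.r x) = w}

/-- The mirror image of a map. -/
def mirror : ColouredMap V X F where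
  __ := M
  σ := M.σ.symm
  -- Reversing the orientation swaps the two sides of a dart.
  face x := M.face (M.r x)
  s_σ x := by rw [← M.s_σ, Equiv.apply_symm_apply]
  sameCycle x y h := (Equiv.Perm.sameCycle_inv (f := M.σ)).2 (M.sameCycle x y h)
  face_σ_r x := by
    rw [← M.face_σ_r, M.r_r, Equiv.apply_symm_apply]
  three_le_face f := by
    refine (M.three_le_face f).trans (Finset.card_le_card_of_injOn M.r ?_ ?_)
    · intro x hx
      simpa [M.r_r] using hx
    · intro x _ y _ h
      rw [← M.r_r x, h, M.r_r]

lemma r_inj {x y : X} (h : M.r x = M.r y) : x = y := by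
  rw [← M.r_r x, h, M.r_r]

@[simp] lemma t_r (x : X) : M.t (M.r x) = M.s x := by simp [t, M.r_r]
lemma s_r' (x : X) : M.s (M.r x) = M.t x := rfl
lemma t_ne_s (x : X) : M.t x ≠ M.s x := M.s_r x
lemma s_σ_symm (x : X) : M.s (M.σ.symm x) = M.s x := M.mirror.s_σ x

lemma isCycleOn (v : V) : M.σ.IsCycleOn ({x | M.s x = v} : Finset X) := by
  constructor
  · refine ⟨fun x hx => ?_, M.σ.injective.injOn, fun x hx => ⟨M.σ.symm x, ?_, by simp⟩⟩
    · simpa [M.s_σ] using hx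
    · simpa [M.s_σ_symm] using hx
  · intro x hx y hy
    exact M.sameCycle x y (by simp at hx hy; rw [hx, hy])

lemma deg_dvd {x : X} {n : ℕ} (h : (M.σ ^ n) x = x) : M.deg (M.s x) ∣ n :=
  ((M.isCycleOn (M.s x)).pow_apply_eq (by simp)).1 h

lemma pow_deg (x : X) : (M.σ ^ M.deg (M.s x)) x = x :=
  ((M.isCycleOn (M.s x)).pow_apply_eq (by simp)).2 dvd_rfl

lemma deg_le {x : X} {n : ℕ} (hn : 0 < n) (h : (M.σ ^ n) x = x) : M.deg (M.s x) ≤ n :=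
  Nat.le_of_dvd hn (M.deg_dvd h)

/-- A sum over the darts at a vertex may be taken along the rotation. -/
lemma sum_darts (x : X) (f : X → ℕ) :
    ∑ y ∈ ({y | M.s y = M.s x} : Finset X), f y =
      ∑ i ∈ range (M.deg (M.s x)), f ((M.σ ^ i) x) := by
  have hc := M.isCycleOn (M.s x)
  have hx : x ∈ ({y | M.s y = M.s x} : Finset X) := by simp
  have hs : ∀ i : ℕ, M.s ((M.σ ^ i) x) = M.s x := by
    intro i
    induction i with
    | zero => rfl
    | succ n ih => rw [pow_succ', Equiv.Perm.mul_apply, M.s_σ, ih]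
  symm
  refine Finset.sum_bij (fun i _ => (M.σ ^ i) x) ?_ ?_ ?_ ?_
  · intro i _
    simp [hs]
  · intro i hi j hj h
    have := (hc.pow_apply_eq_pow_apply hx).1 h
    exact Nat.ModEq.eq_of_lt_of_lt this (mem_range.1 hi) (mem_range.1 hj)
  · intro y hy
    obtain ⟨n, hn, h⟩ := hc.exists_pow_eq hx hy
    exact ⟨n, mem_range.2 hn, h⟩
  · intros; rfl

lemma eleven_le_deg {u : V} (hu : M.kind u = .D) : 11 ≤ M.deg u := by
  rcases M.deg_D u hu with h | h
  · refine h.trans (card_le_card ?_)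
    intro x hx
    simp at hx ⊢
    exact hx.1
  · unfold deg
    omega

lemma three_le_deg' {u : V} (hu : M.kind u = .A) : 3 ≤ M.deg u := M.three_le_deg u hu

end ColouredMap

/-! ### Drawing chords until the map is saturated -/

namespace ColouredMap

variable {V X F : Type*} [Fintype V] [Fintype X] [Fintype F] (M : ColouredMap V X F)

/-- The dart following `x` on the boundary of its face. -/
def φ (x : X) : X := M.σ (M.r x)

lemma face_φ (x : X) : M.face (M.φ x) = M.face x := M.face_σ_r x
lemma s_φ (x : X) : M.s (M.φ x) = M.t x := M.s_σ _
lemma φ_ne (x : X) : M.φ x ≠ x := fun h => M.t_ne_s x (by rw [← M.s_φ, h])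
lemma φ_inj {x y : X} (h : M.φ x = M.φ y) : x = y := M.r_inj (M.σ.injective h)

/-- The rotation after a chord is drawn from the corner before `x` to the corner before
`φ (φ x)`. -/
noncomputable def chordσ (x : X) : Equiv.Perm (X ⊕ Bool) :=
  Equiv.Perm.sumCongr M.σ 1 * Equiv.swap (.inl (M.σ.symm x)) (.inr true) *
    Equiv.swap (.inl (M.r (M.φ x))) (.inr false)

section Chord

variable {M} {x : X}

lemma chord_ne (hx : M.s x ≠ M.t (M.φ x)) : M.σ.symm x ≠ M.r (M.φ x) := by
  intro h
  apply hx
  rw [← M.s_σ_symm x, h]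
  rfl

lemma chordσ_left (hx : M.s x ≠ M.t (M.φ x)) :
    M.chordσ x (.inl (M.σ.symm x)) = .inr true := by
  simp [chordσ, Equiv.swap_apply_def, chord_ne hx]

lemma chordσ_right : M.chordσ x (.inl (M.r (M.φ x))) = .inr false := by
  simp [chordσ, Equiv.swap_apply_def]

lemma chordσ_true : M.chordσ x (.inr true) = .inl x := by
  simp [chordσ, Equiv.swap_apply_def]

lemma chordσ_false (hx : M.s x ≠ M.t (M.φ x)) :
    M.chordσ x (.inr false) = .inl (M.φ (M.φ x)) := by
  simp [chordσ, Equiv.swap_apply_def, (chord_ne hx).symm]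
  rfl

lemma chordσ_of_ne {z : X} (h₁ : z ≠ M.σ.symm x) (h₂ : z ≠ M.r (M.φ x)) :
    M.chordσ x (.inl z) = .inl (M.σ z) := by
  simp [chordσ, Equiv.swap_apply_def, h₁, h₂]

/-- The source of a dart after the chord is drawn. -/
def chordS (M : ColouredMap V X F) (x : X) : X ⊕ Bool → V
  | .inl z => M.s z
  | .inr true => M.s x
  | .inr false => M.t (M.φ x)

/-- The reversal of darts after the chord is drawn. -/
def chordR (M : ColouredMap V X F) : X ⊕ Bool → X ⊕ Bool
  | .inl z => .inl (M.r z)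
  | .inr b => .inr (!b)

/-- The face of a dart after the chord is drawn: the chord cuts off a triangle. -/
noncomputable def chordFace (M : ColouredMap V X F) (x : X) : X ⊕ Bool → Option F
  | .inl z => if z = x ∨ z = M.φ x then none else some (M.face z)
  | .inr true => some (M.face x)
  | .inr false => none

lemma chordS_σ (hx : M.s x ≠ M.t (M.φ x)) (z : X ⊕ Bool) :
    M.chordS x (M.chordσ x z) = M.chordS x z := by
  rcases z with z | b
  · by_cases h₁ : z = M.σ.symm x
    · rw [h₁, chordσ_left hx]
      simp [chordS, M.s_σ_symm]
    by_cases h₂ : z = M.r (M.φ x)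
    · rw [h₂, chordσ_right]
      rfl
    rw [chordσ_of_ne h₁ h₂]
    exact M.s_σ z
  · cases b
    · rw [chordσ_false hx]
      exact M.s_φ _
    · rw [chordσ_true]
      rfl

lemma chord_sameCycle_σ (hx : M.s x ≠ M.t (M.φ x)) (z : X) :
    (M.chordσ x).SameCycle (.inl z) (.inl (M.σ z)) := by
  by_cases h₁ : z = M.σ.symm x
  · refine ⟨2, ?_⟩
    rw [h₁]
    change M.chordσ x (M.chordσ x _) = _
    rw [chordσ_left hx, chordσ_true, Equiv.apply_symm_apply]
  by_cases h₂ : z = M.r (M.φ x)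
  · refine ⟨2, ?_⟩
    rw [h₂]
    change M.chordσ x (M.chordσ x _) = _
    rw [chordσ_right, chordσ_false hx]
    rfl
  exact ⟨1, by rw [zpow_one, chordσ_of_ne h₁ h₂]⟩

lemma chord_sameCycle (hx : M.s x ≠ M.t (M.φ x)) {z z' : X} (h : M.s z = M.s z') :
    (M.chordσ x).SameCycle (.inl z) (.inl z') := by
  obtain ⟨n, rfl⟩ := (M.sameCycle z z' h).exists_nat_pow_eq
  clear h
  induction n with
  | zero => exact Equiv.Perm.SameCycle.refl _ _
  | succ n ih =>
    rw [pow_succ', Equiv.Perm.mul_apply]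
    exact ih.trans (chord_sameCycle_σ hx _)

lemma chord_sameCycle_inl (hx : M.s x ≠ M.t (M.φ x)) (z : X ⊕ Bool) :
    ∃ y, (M.chordσ x).SameCycle z (.inl y) ∧ M.s y = M.chordS x z := by
  rcases z with z | b
  · exact ⟨z, Equiv.Perm.SameCycle.refl _ _, rfl⟩
  · cases b
    · exact ⟨_, ⟨1, by rw [zpow_one, chordσ_false hx]⟩, M.s_φ _⟩
    · exact ⟨_, ⟨1, by rw [zpow_one, chordσ_true]⟩, rfl⟩

/-- The new triangle is the walk `x`, `φ x`, `inr false`; in the old face `inr true` replaces `x`,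
`φ x`. Successors change only at the dart before `x` and at `φ x`. -/
lemma chordFace_φ (hx : M.s x ≠ M.t (M.φ x)) (z : X ⊕ Bool) :
    M.chordFace x (M.chordσ x (M.chordR z)) = M.chordFace x z := by
  have hφφ : M.φ (M.φ x) ≠ x := fun h => hx (by rw [← M.s_φ, h])
  rcases z with z | b
  · by_cases h₁ : M.r z = M.σ.symm x
    · have h : M.φ z = x := by rw [φ, h₁, Equiv.apply_symm_apply]
      have hz : z ≠ x := fun h' => M.φ_ne x (by rw [← h', h, h'])
      have hz' : z ≠ M.φ x := fun h' => hφφ (by rw [← h', h])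
      simp only [chordR]
      rw [h₁, chordσ_left hx]
      simp only [chordFace, hz, hz', or_self, if_false]
      rw [← M.face_φ z, h]
    by_cases h₂ : M.r z = M.r (M.φ x)
    · have h : z = M.φ x := M.r_inj h₂
      simp only [chordR]
      rw [h₂, chordσ_right, h]
      simp [chordFace]
    · have h : M.φ z ≠ x := fun h => h₁ (by rw [← h, φ, Equiv.symm_apply_apply])
      have h' : z ≠ M.φ x := fun h => h₂ (by rw [h])
      simp only [chordR]
      rw [chordσ_of_ne h₁ h₂]
      change chordFace M x (.inl (M.φ z)) = _
      by_cases hz : z = x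
      · simp [chordFace, hz]
      · have : M.φ z ≠ M.φ x := fun h => hz (M.φ_inj h)
        simp [chordFace, hz, h, h', this, M.face_φ]
  · cases b
    · simp [chordR, chordσ_true, chordFace]
    · simp only [chordR, Bool.not_true]
      rw [chordσ_false hx]
      simp [chordFace, hφφ, M.φ_ne, M.face_φ]

/-- The old face loses two darts and gains one, which is why it must have length at least 4. -/
lemma three_le_chordFace (hx : M.s x ≠ M.t (M.φ x)) (h4 : 4 ≤ M.len (M.face x)) (f : Option F) :
    3 ≤ #{z | M.chordFace x z = f} := by
  have hne := M.φ_ne x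
  cases f with
  | none =>
    have : ({.inl x, .inl (M.φ x), .inr false} : Finset (X ⊕ Bool)) ⊆
        ({z | M.chordFace x z = none} : Finset _) := by
      intro z hz
      simp only [mem_insert, mem_singleton] at hz
      rw [mem_filter_univ]
      rcases hz with rfl | rfl | rfl <;> simp [chordFace]
    refine le_trans (le_of_eq ?_) (card_le_card this)
    rw [card_eq_three.2 ⟨_, _, _, _, _, _, rfl⟩] <;> simp [hne.symm]
  | some f =>
    by_cases hf : f = M.face x
    · have : (insert (.inr true)
          ((((({z | M.face z = f} : Finset X).erase x).erase (M.φ x))).map ⟨Sum.inl, Sum.inl_injective⟩) :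
            Finset (X ⊕ Bool)) ⊆ ({z | M.chordFace x z = some f} : Finset _) := by
        intro z hz
        simp only [mem_insert, mem_map, mem_erase, mem_filter_univ, Function.Embedding.coeFn_mk]
          at hz
        rcases hz with rfl | ⟨y, ⟨h1, h2, h3⟩, rfl⟩
        · rw [mem_filter_univ]
          simp [chordFace, hf]
        · rw [mem_filter_univ]
          simp [chordFace, h1, h2, h3]
      refine le_trans ?_ (card_le_card this)
      rw [card_insert_of_notMem (by simp), card_map, card_erase_of_mem, card_erase_of_mem]
      · rw [hf]
        unfold len at h4
        omega
      · simp [hf]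
      · simp [hf, hne, M.face_φ]
    · refine (M.three_le_face f).trans (card_le_card_of_injOn Sum.inl ?_ Sum.inl_injective.injOn)
      intro z hz
      have hz : M.face z = f := by simpa using hz
      have h1 : z ≠ x := by rintro rfl; exact hf hz.symm
      have h2 : z ≠ M.φ x := by rintro rfl; exact hf (by rw [← hz, M.face_φ])
      rw [mem_coe, mem_filter_univ]
      simp [chordFace, h1, h2, hz]

lemma nbr_subset_chord (v : V) :
    ({w | M.kind w = .D ∧ ∃ z, M.s z = v ∧ M.s (M.r z) = w} : Finset V) ⊆
      ({w | M.kind w = .D ∧ ∃ z, M.chordS x z = v ∧ M.chordS x (M.chordR z) = w} : Finset V) := by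
  intro w hw
  simp only [mem_filter_univ] at hw ⊢
  obtain ⟨h, z, h1, h2⟩ := hw
  exact ⟨h, .inl z, h1, h2⟩

/-- A chord joining two vertices at distance two along the boundary of a face. -/
noncomputable def chord (hx : M.s x ≠ M.t (M.φ x))
    (hA : M.kind (M.s x) = .A → M.kind (M.t (M.φ x)) ≠ .A) (h4 : 4 ≤ M.len (M.face x)) :
    ColouredMap V (X ⊕ Bool) (Option F) where
  kind := M.kind
  σ := M.chordσ x
  r := M.chordR
  s := M.chordS x
  face := M.chordFace x
  r_r z := by
    rcases z with z | b
    · simp [chordR, M.r_r]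
    · simp [chordR]
  s_r z := by
    rcases z with z | b
    · exact M.s_r z
    · cases b
      · exact hx
      · exact hx.symm
  s_σ := chordS_σ hx
  sameCycle z z' h := by
    obtain ⟨y, hy, hy'⟩ := chord_sameCycle_inl hx z
    obtain ⟨w, hw, hw'⟩ := chord_sameCycle_inl hx z'
    exact (hy.trans (chord_sameCycle hx (by rw [hy', hw', h]))).trans hw.symm
  face_σ_r := chordFace_φ hx
  three_le_face f := by convert three_le_chordFace hx h4 f
  euler := by
    have := M.euler
    simp only [Fintype.card_sum, Fintype.card_bool, Fintype.card_option]
    omega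
  indep z := by
    rcases z with z | b
    · exact M.indep z
    · cases b
      · exact fun h h' => hA h' h
      · exact hA
  three_le_deg v hv := by
    refine (M.three_le_deg v hv).trans (card_le_card_of_injOn Sum.inl ?_ Sum.inl_injective.injOn)
    intro z hz
    rw [mem_coe, mem_filter_univ] at hz ⊢
    exact hz
  two_le_nbr v hv := (M.two_le_nbr v hv).trans (card_le_card (nbr_subset_chord v))
  nbr_inj v₁ v₂ h₁ h₂ h h' := by
    -- `D`-neighbourhoods only grow and had at least two elements, so one of size 2 has not changed.
    have key : ∀ v, M.kind v = .C →
        #{w | M.kind w = .D ∧ ∃ z, M.chordS x z = v ∧ M.chordS x (M.chordR z) = w} = 2 →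
        ({w | M.kind w = .D ∧ ∃ z, M.s z = v ∧ M.s (M.r z) = w} : Finset V) =
        ({w | M.kind w = .D ∧ ∃ z, M.chordS x z = v ∧ M.chordS x (M.chordR z) = w} : Finset V) :=
      fun v hv hc => eq_of_subset_of_card_le (nbr_subset_chord v)
        (by rw [hc]; exact M.two_le_nbr v hv)
    have h'' : ({w | M.kind w = .D ∧ ∃ z, M.chordS x z = v₁ ∧ M.chordS x (M.chordR z) = w} :
        Finset V) =
        ({w | M.kind w = .D ∧ ∃ z, M.chordS x z = v₂ ∧ M.chordS x (M.chordR z) = w} : Finset V) := by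
      ext w
      simpa using Set.ext_iff.1 h' w
    have e₁ := key v₁ h₁ h
    have e₂ := key v₂ h₂ (by rw [← h'', h])
    refine M.nbr_inj v₁ v₂ h₁ h₂ (by rw [e₁, h]) ?_
    have := e₁.trans (h''.trans e₂.symm)
    ext w
    simpa using Finset.ext_iff.1 this w
  deg_D u hu := by
    refine (M.deg_D u hu).imp (fun h => h.trans ?_) (fun h => h.trans ?_)
    · refine card_le_card_of_injOn Sum.inl ?_ Sum.inl_injective.injOn
      intro z hz
      rw [mem_coe, mem_filter_univ] at hz ⊢
      exact hz
    · refine card_le_card_of_injOn Sum.inl ?_ Sum.inl_injective.injOn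
      intro z hz
      rw [mem_coe, mem_filter_univ] at hz ⊢
      exact hz

end Chord

/-- No chord can be drawn. -/
def Saturated : Prop :=
  ∀ x, 4 ≤ M.len (M.face x) →
    M.s x = M.t (M.φ x) ∨ (M.kind (M.s x) = .A ∧ M.kind (M.t (M.φ x)) = .A)

lemma sum_len : ∑ f, M.len f = Fintype.card X := by
  have := card_eq_sum_card_fiberwise (s := (univ : Finset X)) (t := univ) (f := M.face) (by simp)
  exact this.symm

/-- Faces of length at least 3 give `3|F| ≤ |X|`, and Euler's inequality then bounds the darts. -/
lemma card_le (M : ColouredMap V X F) : Fintype.card X ≤ 6 * Fintype.card V := by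
  have h : ∑ _f : F, 3 ≤ ∑ f, M.len f := sum_le_sum fun f _ => M.three_le_face f
  rw [M.sum_len, sum_const, card_univ, smul_eq_mul] at h
  have := M.euler
  omega

end ColouredMap

/-- A map with the most darts is saturated. -/
lemma ColouredMap.false_of_saturated.{u, v} {V : Type*} [Fintype V]
    (h : ∀ (X : Type u) (F : Type v) [Fintype X] [Fintype F] (M : ColouredMap V X F),
      M.Saturated → False)
    (X : Type u) (F : Type v) [Fintype X] [Fintype F] (M : ColouredMap V X F) : False := by
  -- The measure is the room left under `card_le`; each chord takes two darts of it. The types `X ⊕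
  -- Bool` and `Option F` stay in the same universes, so the induction can range over them.
  induction hn : 6 * Fintype.card V - Fintype.card X using Nat.strong_induction_on
    generalizing X F with
  | _ n ih =>
    by_cases hM : M.Saturated
    · exact h X F M hM
    · unfold Saturated at hM
      push Not at hM
      obtain ⟨x, h4, hx, hA⟩ := hM
      have hle := (M.chord hx hA h4).card_le
      refine ih _ ?_ _ _ (M.chord hx hA h4) rfl
      simp only [Fintype.card_sum, Fintype.card_bool] at hle ⊢
      omega

/-! ### Triangles in saturated maps, and vertices with two darts to `D` -/

namespace ColouredMap

variable {V X F : Type*} [Fintype V] [Fintype X] [Fintype F] {M : ColouredMap V X F}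

lemma mem_nbr {v w : V} : w ∈ M.nbr v ↔ M.kind w = .D ∧ ∃ x, M.s x = v ∧ M.t x = w := by
  rw [nbr, mem_filter_univ]
  rfl

lemma t_mem_nbr {x : X} (h : M.kind (M.t x) = .D) : M.t x ∈ M.nbr (M.s x) :=
  mem_nbr.2 ⟨h, x, rfl, rfl⟩

lemma len_mirror (f : F) : M.mirror.len f = M.len f := by
  refine card_bij (fun x _ => M.r x) ?_ ?_ ?_
  · intro x hx
    rw [mem_filter_univ] at hx ⊢
    exact hx
  · intro x _ y _ h
    exact M.r_inj h
  · intro x hx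
    refine ⟨M.r x, ?_, M.r_r x⟩
    rw [mem_filter_univ] at hx ⊢
    rw [← hx]
    exact congrArg M.face (M.r_r x)

/-- A missing chord of the mirror image is a missing chord read backwards. Hence each left-handed
statement about saturated maps has a right-handed twin. -/
lemma Saturated.mirror (hM : M.Saturated) : M.mirror.Saturated := by
  intro x hx
  set y := M.r (M.σ.symm (M.r x)) with hy
  have h : M.φ y = M.r x := by rw [φ, hy, M.r_r, Equiv.apply_symm_apply]
  rw [len_mirror] at hx
  have := hM y (by rw [← M.face_φ, h]; exact hx)
  rw [h, t_r] at this
  exact this.imp Eq.symm And.symm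

/-- A face may consist of several boundary walks, so this needs an argument: without loops `φ` has
no fixed point, and a fixed-point-free permutation of three darts is a 3-cycle. -/
lemma φ_φ_φ {x : X} (h : M.len (M.face x) = 3) : M.φ (M.φ (M.φ x)) = x := by
  have h₁ := M.φ_ne x
  have key : ∀ y, M.face y = M.face x → y ≠ x → y ≠ M.φ x → ∀ z, M.face z = M.face x →
      z = x ∨ z = M.φ x ∨ z = y := by
    intro y hy hyx hyφ z hz
    have : ({x, M.φ x, y} : Finset X) = ({y | M.face y = M.face x} : Finset X) := by
      refine eq_of_subset_of_card_le ?_ ?_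
      · intro w hw
        simp only [mem_insert, mem_singleton] at hw
        rw [mem_filter_univ]
        rcases hw with rfl | rfl | rfl <;> simp [M.face_φ, hy]
      · change M.len _ ≤ _
        rw [h, card_eq_three.2 ⟨x, M.φ x, y, h₁.symm, hyx.symm, hyφ.symm, rfl⟩]
    have hz' : z ∈ ({x, M.φ x, y} : Finset X) := by rw [this, mem_filter_univ, hz]
    simpa using hz'
  have h₂ : M.φ (M.φ x) ≠ x := by
    intro h₂
    obtain ⟨y, hy, hy'⟩ : ∃ y ∈ ({y | M.face y = M.face x} : Finset X), y ∉ ({x, M.φ x} : Finset X) := by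
      refine exists_mem_notMem_of_card_lt_card ?_
      change _ < M.len _
      rw [h]
      exact card_le_two.trans_lt (by norm_num)
    rw [mem_filter_univ] at hy
    simp only [mem_insert, mem_singleton, not_or] at hy'
    rcases key y hy hy'.1 hy'.2 (M.φ y) (by rw [M.face_φ, hy]) with e | e | e
    · exact hy'.2 (M.φ_inj (e.trans h₂.symm))
    · exact hy'.1 (M.φ_inj e)
    · exact M.φ_ne y e
  rcases key (M.φ (M.φ x)) (by simp [M.face_φ]) h₂ (M.φ_ne _) (M.φ (M.φ (M.φ x)))
    (by simp [M.face_φ]) with e | e | e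
  · exact e
  · exact absurd (M.φ_inj e) h₂
  · exact absurd e (M.φ_ne _)

/-- In a saturated map, a corner between darts with distinct targets, not both in `A`, belongs to
a triangle. -/
lemma Saturated.σ_r_φ (hM : M.Saturated) {p : X} (hne : M.t p ≠ M.t (M.σ p))
    (hA : M.kind (M.t p) = .A → M.kind (M.t (M.σ p)) ≠ .A) :
    M.σ (M.r (M.φ (M.σ p))) = M.r p := by
  have h : M.φ (M.r p) = M.σ p := by rw [φ, M.r_r]
  have h3 : M.len (M.face (M.r p)) = 3 := by
    have h3 := M.three_le_face (M.face (M.r p))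
    by_contra hc
    have h4 : 4 ≤ M.len (M.face (M.r p)) := by
      unfold len at hc ⊢
      omega
    have := hM _ h4
    rw [h] at this
    rcases this with h' | h'
    · exact hne h'
    · exact hA h'.1 h'.2
  have := φ_φ_φ h3
  rwa [h] at this

lemma Saturated.t_φ_σ (hM : M.Saturated) {p : X} (hne : M.t p ≠ M.t (M.σ p))
    (hA : M.kind (M.t p) = .A → M.kind (M.t (M.σ p)) ≠ .A) :
    M.t (M.φ (M.σ p)) = M.t p := by
  rw [t, ← M.s_σ, hM.σ_r_φ hne hA]
  rfl

/-- In a triangle the third side would join the two targets, making a loop or an edge inside `A`. -/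
lemma four_le_len {p : X} (h : M.t p = M.t (M.σ p) ∨
    M.kind (M.t p) = .A ∧ M.kind (M.t (M.σ p)) = .A) : 4 ≤ M.len (M.face (M.σ p)) := by
  have h3 := M.three_le_face (M.face (M.σ p))
  change 3 ≤ M.len _ at h3
  by_contra hc
  have h3' : M.len (M.face (M.σ p)) = 3 := by omega
  have e : M.φ (M.r p) = M.σ p := by rw [φ, M.r_r]
  have := φ_φ_φ h3'
  rw [← e, M.face_φ] at h3'
  have e' := φ_φ_φ h3'
  rw [e] at e'
  have ht : M.t (M.φ (M.σ p)) = M.t p := by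
    rw [← M.s_φ, e']
    rfl
  have hs := M.s_φ (M.σ p)
  rcases h with h | h
  · exact M.t_ne_s (M.φ (M.σ p)) (by rw [ht, hs, h])
  · exact M.indep (M.φ (M.σ p)) (by rw [hs]; exact h.2) (by rw [← t, ht]; exact h.1)

/-- If two consecutive corners at a vertex are triangles and their outer sides join the same two
vertices, and there is just one edge between these, then one of them has degree two. -/
lemma Saturated.deg_le_two (hM : M.Saturated) {p : X} (h : M.t (M.σ (M.σ p)) = M.t p)
    (hne : M.t p ≠ M.t (M.σ p)) (hA : M.kind (M.t p) = .A → M.kind (M.t (M.σ p)) ≠ .A)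
    (huniq : ∀ x y, M.s x = M.t (M.σ p) → M.t x = M.t p → M.s y = M.t (M.σ p) →
      M.t y = M.t p → x = y) : M.deg (M.t (M.σ p)) ≤ 2 := by
  have hne' : M.t (M.σ p) ≠ M.t (M.σ (M.σ p)) := by rw [h]; exact hne.symm
  have hA' : M.kind (M.t (M.σ p)) = .A → M.kind (M.t (M.σ (M.σ p))) ≠ .A := by
    rw [h]; exact fun a b => hA b a
  -- The outer sides of both triangles join the same two vertices, so they are one edge, and the
  -- rotation at the middle vertex closes after two steps.
  have e := huniq (M.φ (M.σ p)) (M.r (M.φ (M.σ (M.σ p)))) (M.s_φ _) (hM.t_φ_σ hne hA)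
    (hM.t_φ_σ hne' hA') (by rw [t_r, M.s_φ, h])
  have h1 := hM.σ_r_φ hne' hA'
  rw [← e] at h1
  have h2 : (M.σ ^ 2) (M.r (M.σ p)) = M.r (M.σ p) := by
    rw [pow_two, Equiv.Perm.mul_apply]
    exact h1
  exact M.deg_le two_pos h2

variable (M) in
/-- The vertices of class `C` with exactly two darts to `D`. -/
def C2 (v : V) : Prop := M.kind v = .C ∧ #{x | M.s x = v ∧ M.kind (M.t x) = .D} = 2

variable (M) in
/-- The vertices of class `C` with more than two darts to `D`. -/
def C3 (v : V) : Prop := M.kind v = .C ∧ #{x | M.s x = v ∧ M.kind (M.t x) = .D} ≠ 2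

lemma nbr_eq_image (v : V) :
    M.nbr v = ({x | M.s x = v ∧ M.kind (M.t x) = .D} : Finset X).image M.t := by
  ext w
  simp only [mem_nbr, mem_image, mem_filter_univ]
  constructor
  · rintro ⟨h, x, hx, rfl⟩
    exact ⟨x, ⟨hx, h⟩, rfl⟩
  · rintro ⟨x, ⟨hx, h⟩, rfl⟩
    exact ⟨h, x, hx, rfl⟩

lemma two_le_card_nbr {v : V} (h : M.kind v = .C) : 2 ≤ #(M.nbr v) := M.two_le_nbr v h

lemma two_le_card_toD {v : V} (h : M.kind v = .C) :
    2 ≤ #{x | M.s x = v ∧ M.kind (M.t x) = .D} := by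
  have := two_le_card_nbr h
  rw [nbr_eq_image] at this
  exact this.trans card_image_le

lemma C2.card_nbr {v : V} (h : M.C2 v) : #(M.nbr v) = 2 := by
  refine le_antisymm ?_ (two_le_card_nbr h.1)
  rw [nbr_eq_image, ← h.2]
  exact card_image_le

/-- Two darts reach at least two vertices of `D`, so `t` is injective on them. -/
lemma C2.dart_unique {x y : X} (h : M.C2 (M.s x)) (hx : M.kind (M.t x) = .D)
    (hs : M.s y = M.s x) (ht : M.t y = M.t x) : y = x := by
  have hc := h.card_nbr
  rw [← h.2, nbr_eq_image] at hc
  have := card_image_iff.1 hc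
  refine this ?_ ?_ ht
  · rw [mem_coe, mem_filter_univ]
    exact ⟨hs, by rw [ht, hx]⟩
  · rw [mem_coe, mem_filter_univ]
    exact ⟨rfl, hx⟩

lemma C2.dart_unique' {x y : X} (h : M.C2 (M.t x)) (hx : M.kind (M.s x) = .D)
    (hs : M.s y = M.s x) (ht : M.t y = M.t x) : y = x :=
  M.r_inj (C2.dart_unique (x := M.r x) (y := M.r y) h (by rwa [t_r]) ht (by rw [t_r, t_r, hs]))

lemma C2.exists_ne {x : X} (h : M.C2 (M.s x)) :
    ∃ y, M.s y = M.s x ∧ M.kind (M.t y) = .D ∧ y ≠ x := by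
  have h2 := h.2
  obtain ⟨y, hy, hne⟩ := exists_mem_ne (by rw [h2]; norm_num) x
  rw [mem_filter_univ] at hy
  exact ⟨y, hy.1, hy.2, hne⟩

/-- The vertices `u`, `w` exhaust both `D`-neighbourhoods. The hypothesis that such neighbourhoods
are distinct enters the discharging in this form. -/
lemma C2.eq_of_nbr {v₁ v₂ u w : V} (h₁ : M.C2 v₁) (h₂ : M.C2 v₂) (hne : u ≠ w)
    (hu₁ : u ∈ M.nbr v₁) (hw₁ : w ∈ M.nbr v₁) (hu₂ : u ∈ M.nbr v₂) (hw₂ : w ∈ M.nbr v₂) :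
    v₁ = v₂ := by
  have key : ∀ v, M.C2 v → u ∈ M.nbr v → w ∈ M.nbr v → {u, w} = M.nbr v := by
    intro v hv hu hw
    refine eq_of_subset_of_card_le ?_ ?_
    · intro z hz
      rw [mem_insert, mem_singleton] at hz
      rcases hz with rfl | rfl <;> assumption
    · rw [hv.card_nbr, card_pair hne]
  have e := (key v₁ h₁ hu₁ hw₁).symm.trans (key v₂ h₂ hu₂ hw₂)
  refine M.nbr_inj v₁ v₂ h₁.1 h₂.1 h₁.card_nbr ?_
  ext z
  simpa [nbr] using Finset.ext_iff.1 e z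

lemma C2.two_lt_of_iterate {g : X} (h : M.C2 (M.s g)) (hg : M.kind (M.t (M.σ g)) ≠ .D) :
    M.σ (M.σ g) ≠ g := by
  intro e
  obtain ⟨y, hy, hD, hne⟩ := h.exists_ne
  obtain ⟨n, hn⟩ := (M.sameCycle g y hy.symm).exists_nat_pow_eq
  have : ∀ n : ℕ, (M.σ ^ n) g = g ∨ (M.σ ^ n) g = M.σ g := by
    intro n
    induction n with
    | zero => exact .inl rfl
    | succ n ih =>
      rw [pow_succ', Equiv.Perm.mul_apply]
      rcases ih with h | h <;> rw [h]
      · exact .inr rfl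
      · exact .inl e
  rcases this n with h' | h' <;> rw [hn] at h'
  · exact hne h'
  · exact hg (h' ▸ hD)

end ColouredMap

/-! ### Good darts, and the surroundings of a bad one -/

namespace ColouredMap

variable {V X F : Type*} [Fintype V] [Fintype X] [Fintype F] {M : ColouredMap V X F}

variable (M) in
/-- The next dart around the source of `p`, disregarding one dart to `A`, leads to a common
neighbour in `D` of the two ends of `p`. -/
def Good (p : X) : Prop :=
  M.t (M.σ p) ∈ M.nbr (M.t p) ∨
    M.kind (M.t (M.σ p)) = .A ∧ M.t (M.σ (M.σ p)) ∈ M.nbr (M.t p)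

/-- At a vertex of degree three, three consecutive darts are all the darts. -/
lemma σ_σ_σ {p : X} (h : M.deg (M.s p) = 3) : M.σ (M.σ (M.σ p)) = p := by
  have := M.pow_deg p
  rw [h] at this
  exact this

/-- A dart from a vertex `v` with exactly two darts to `D` to a vertex `u` in `D` is good on the
left of its reverse at `u`, or the next vertex around `v` is in `A` and of degree at least four, or
the next vertex not in `A` is in `C` and a neighbour of `u`. -/
lemma Saturated.good_or (hM : M.Saturated) {g : X} (hv : M.C2 (M.s g))
    (hu : M.kind (M.t g) = .D) :
    M.mirror.Good (M.r g) ∨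
      (M.kind (M.t (M.σ g)) = .A ∧ 4 ≤ M.deg (M.t (M.σ g))) ∨
      (M.kind (M.t (M.σ g)) = .C ∧ M.t g ∈ M.nbr (M.t (M.σ g))) ∨
      (M.kind (M.t (M.σ g)) = .A ∧ M.kind (M.t (M.σ (M.σ g))) = .C ∧
        M.t g ∈ M.nbr (M.t (M.σ (M.σ g)))) := by
  set y := M.σ g with hy
  have hAu : M.kind (M.t g) = .A → M.kind (M.t y) ≠ .A := by simp [hu]
  -- Otherwise `y = g`, and `g` is the only dart at its source.
  have hyu : M.t y ≠ M.t g := by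
    intro e
    have h := hv.dart_unique hu (M.s_σ g) e
    obtain ⟨x, hx, -, hne⟩ := hv.exists_ne
    obtain ⟨n, hn⟩ := (M.sameCycle g x hx.symm).exists_nat_pow_eq
    apply hne
    rw [← hn]
    exact Equiv.Perm.pow_apply_eq_self_of_apply_eq_self h n
  -- the triangle at the corner of `g` and `y`
  set z := M.φ y with hz
  have hz1 : M.σ (M.r z) = M.r g := hM.σ_r_φ hyu.symm hAu
  have hz2 : M.t z = M.t g := hM.t_φ_σ hyu.symm hAu
  have hz3 : M.s z = M.t y := M.s_φ y
  have hz4 : M.σ (M.r y) = z := rfl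
  have hz5 : M.mirror.σ (M.r g) = M.r z := by
    rw [← hz1]
    exact Equiv.symm_apply_apply _ _
  have hvy : M.s y = M.s g := M.s_σ g
  cases hk : M.kind (M.t y) with
  | D =>
    refine .inl (.inl ?_)
    change M.t _ ∈ M.nbr (M.t (M.r g))
    rw [hz5, t_r, t_r, hz3, ← hvy]
    exact t_mem_nbr hk
  | C =>
    refine .inr (.inr (.inl ⟨rfl, mem_nbr.2 ⟨hu, z, hz3, hz2⟩⟩))
  | A =>
    by_cases h4 : 4 ≤ M.deg (M.t y)
    · exact .inr (.inl ⟨rfl, h4⟩)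
    have h3 : M.deg (M.t y) = 3 := by
      have := M.three_le_deg' hk
      omega
    set y₂ := M.σ y with hy₂
    have hvy₂ : M.s y₂ = M.s g := (M.s_σ y).trans hvy
    by_cases hk₂ : M.kind (M.t y₂) = .A
    · -- two consecutive darts to `A` only occur in a large face
      exfalso
      have hlen := four_le_len (p := y) (.inr ⟨hk, hk₂⟩)
      set b := M.σ.symm (M.r y) with hb
      have hb1 : M.σ b = M.r y := M.σ.apply_symm_apply _
      have hφb : M.φ (M.r b) = M.r y := by rw [φ, M.r_r, hb1]
      have hφy : M.φ (M.r y) = M.σ y := by rw [φ, M.r_r]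
      -- The preceding corner along this large face forces `b` to lead back to the source of `g`. So
      -- the darts at the vertex in `A` lead to that source, to `t g` and to the source again, and
      -- `t g` would have degree at most two.
      have htb := hM (M.r b) (by rwa [← M.face_φ, hφb, ← M.face_φ, hφy])
      rw [hφb, t_r, s_r', hvy, hv.1] at htb
      have htb : M.t b = M.s g := by simpa using htb
      have h3b : M.deg (M.s b) = 3 := by rw [← M.s_σ, hb1, s_r', h3]
      have hσz : M.σ z = b := by
        have := σ_σ_σ h3b
        rwa [hb1, hz4] at this
      have hty : M.t (M.r y) = M.s g := by rw [t_r, hvy]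
      have := hM.deg_le_two (p := M.r y) (by rw [hz4, hσz, hty, htb])
        (by rw [hz4, hty, hz2]; exact (M.t_ne_s g).symm) (by rw [hty, hv.1]; simp)
        (by
          rw [hz4, hty, hz2]
          intro x x' hx hx' hxs hxt
          refine C2.dart_unique' (by rwa [hxt]) (by rwa [hxs]) (by rw [hx, hxs]) (by rw [hx', hxt]))
      rw [hz4, hz2] at this
      have := M.eleven_le_deg hu
      omega
    have hne₂ : M.t y ≠ M.t y₂ := fun e => hk₂ (e ▸ hk)
    set z₂ := M.φ y₂ with hz₂
    have hz₂1 : M.σ (M.r z₂) = M.r y := hM.σ_r_φ hne₂ fun _ => hk₂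
    have hz₂2 : M.t z₂ = M.t y := hM.t_φ_σ hne₂ fun _ => hk₂
    have hz₂3 : M.s z₂ = M.t y₂ := M.s_φ y₂
    have hσz : M.σ z = M.r z₂ := by
      have : M.deg (M.s (M.r z₂)) = 3 := by
        rw [s_r', hz₂2, h3]
      have := σ_σ_σ this
      rwa [hz₂1, hz4] at this
    have hy₂u : M.t y₂ ≠ M.t g := by
      intro e
      have h := hv.dart_unique hu hvy₂ e
      exact hv.two_lt_of_iterate (by rw [← hy, hk]; simp) h
    -- the triangle at the third corner of the vertex in `A`
    have hne₃ : M.t z ≠ M.t (M.σ z) := by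
      rw [hσz, t_r, hz₂3, hz2]
      exact hy₂u.symm
    have hA₃ : M.kind (M.t z) = .A → M.kind (M.t (M.σ z)) ≠ .A := by
      rw [hz2, hu]
      simp
    have h1 := hM.σ_r_φ hne₃ hA₃
    have h2 := hM.t_φ_σ hne₃ hA₃
    have h3' := M.s_φ (M.σ z)
    set z₃ := M.φ (M.σ z) with hz₃
    rw [hσz, t_r, hz₂3] at h3'
    rw [hz2] at h2
    cases hk₃ : M.kind (M.t y₂) with
    | A => exact absurd hk₃ hk₂
    | C =>
      exact .inr (.inr (.inr ⟨rfl, rfl, mem_nbr.2 ⟨hu, z₃, h3', h2⟩⟩))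
    | D =>
      refine .inl (.inr ?_)
      change M.kind (M.t (M.mirror.σ (M.r g))) = .A ∧
        M.t (M.mirror.σ (M.mirror.σ (M.r g))) ∈ M.nbr (M.t (M.r g))
      have e : M.mirror.σ (M.r z) = M.r z₃ := by
        rw [← h1]
        exact Equiv.symm_apply_apply _ _
      rw [hz5, e, t_r, t_r, t_r, h3', hz3, ← hvy₂]
      exact ⟨hk, t_mem_nbr hk₃⟩

end ColouredMap

/-! ### Paying for bad darts -/

namespace ColouredMap

variable {V X F : Type*} [Fintype V] [Fintype X] [Fintype F] {M : ColouredMap V X F}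

lemma mirror_good {p : X} : M.mirror.Good p ↔ M.t (M.σ.symm p) ∈ M.nbr (M.t p) ∨
    M.kind (M.t (M.σ.symm p)) = .A ∧ M.t (M.σ.symm (M.σ.symm p)) ∈ M.nbr (M.t p) := Iff.rfl

lemma exists_pow_lt {x y : X} {k : ℕ} (hk : 0 < k) (h : (M.σ ^ k) x = x) (hy : M.s y = M.s x) :
    ∃ n < k, (M.σ ^ n) x = y := by
  obtain ⟨n, hn, hn'⟩ := (M.isCycleOn (M.s x)).exists_pow_eq (a := x) (b := y) (by simp)
    (by simp [hy])
  exact ⟨n, hn.trans_le (M.deg_le hk h), hn'⟩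

lemma C_iff {v : V} : M.kind v = .C ↔ M.C2 v ∨ M.C3 v := by
  unfold C2 C3
  tauto

/-- Payment for the darts from `D` to vertices with two darts to `D` that are not good on the
left. -/
lemma Saturated.card_bad_le (hM : M.Saturated) :
    #{p | M.kind (M.s p) = .D ∧ M.C2 (M.t p) ∧ ¬ M.mirror.Good p} ≤
      #{b | M.kind (M.s b) = .A ∧ 4 ≤ M.deg (M.s b) ∧ M.C2 (M.t b) ∧ M.kind (M.t (M.σ b)) = .D} +
      #{h | M.C2 (M.s h) ∧ M.kind (M.t h) = .C ∧ M.mirror.Good h} := by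
  rw [← card_filter_add_card_filter_not
    (fun p => M.kind (M.t (M.σ (M.r p))) = .A ∧ 4 ≤ M.deg (M.t (M.σ (M.r p))))]
  refine add_le_add ?_ ?_
  -- The adjacent vertex of `A` has degree at least 4: it pays through its dart to the `C2`-vertex,
  -- which the triangle makes precede a dart to `D`.
  · refine card_le_card_of_injOn (fun p => M.r (M.σ (M.r p))) ?_ ?_
    · intro p hp
      simp only [coe_filter, mem_filter_univ, Set.mem_ofPred_eq] at hp
      obtain ⟨⟨hD, hC, -⟩, hA, h4⟩ := hp
      rw [mem_coe, mem_filter_univ, s_r', t_r, M.s_σ, s_r']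
      refine ⟨hA, h4, hC, ?_⟩
      change M.kind (M.t (M.φ (M.σ (M.r p)))) = .D
      rw [hM.t_φ_σ, t_r, hD]
      · intro e
        rw [t_r] at e
        rw [← e, hD] at hA
        simp at hA
      · rw [t_r, hD]
        simp
    · intro p _ q _ h
      exact M.r_inj (M.σ.injective (M.r_inj h))
  -- By `good_or`, the rotation at the `C2`-vertex leads in one or two steps to a dart into `C`,
  -- which pays. Going back, past a dart to `A` if there is one, recovers `p`.
  · refine card_le_card_of_injOn
      (fun p => if M.kind (M.t (M.σ (M.r p))) = .C then M.σ (M.r p) else M.σ (M.σ (M.r p))) ?_ ?_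
    · intro p hp
      simp only [coe_filter, mem_filter_univ, Set.mem_ofPred_eq] at hp
      obtain ⟨⟨hD, hC, hG⟩, hA⟩ := hp
      rw [mem_coe, mem_filter_univ, mirror_good]
      beta_reduce
      have hg := hM.good_or (g := M.r p) hC (by rwa [t_r])
      rw [M.r_r] at hg
      rcases hg with hg | hg | ⟨hg, hn⟩ | ⟨hg, hg', hn⟩
      · exact absurd hg hG
      · exact absurd hg hA
      · rw [if_pos hg, M.s_σ, Equiv.symm_apply_apply]
        exact ⟨hC, hg, .inl hn⟩
      · rw [if_neg (by rw [hg]; simp), M.s_σ, M.s_σ, Equiv.symm_apply_apply,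
          Equiv.symm_apply_apply]
        exact ⟨hC, hg', .inr ⟨hg, hn⟩⟩
    · intro p hp q hq h
      simp only [coe_filter, mem_filter_univ, Set.mem_ofPred_eq] at hp hq
      have hp' : M.kind (M.t (M.r p)) = .D := by rw [t_r]; exact hp.1.1
      have hq' : M.kind (M.t (M.r q)) = .D := by rw [t_r]; exact hq.1.1
      dsimp only at h
      split_ifs at h with h1 h2 h2
      · exact M.r_inj (M.σ.injective h)
      · have := M.σ.injective h
        have hg := hM.good_or (g := M.r q) hq.1.2.1 hq'
        rw [M.r_r, ← this, hp'] at hg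
        rcases hg with hg | hg | ⟨hg, hn⟩ | ⟨hg, hg', hn⟩
        · exact absurd hg hq.1.2.2
        all_goals simp at hg
      · have := M.σ.injective h
        have hg := hM.good_or (g := M.r p) hp.1.2.1 hp'
        rw [M.r_r, this, hq'] at hg
        rcases hg with hg | hg | ⟨hg, hn⟩ | ⟨hg, hg', hn⟩
        · exact absurd hg hp.1.2.2
        all_goals simp at hg
      · exact M.r_inj (M.σ.injective (M.σ.injective h))

lemma exists_next_of_good {p : X} (h : M.Good p) :
    ∃ i, 1 ≤ i ∧ i ≤ 2 ∧ M.t ((M.σ ^ i) p) ∈ M.nbr (M.t p) ∧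
      ∀ j < i, 1 ≤ j → M.kind (M.t ((M.σ ^ j) p)) = .A := by
  rcases h with h | h
  · exact ⟨1, le_rfl, by norm_num, h, by omega⟩
  · refine ⟨2, by norm_num, le_rfl, h.2, fun j hj hj' => ?_⟩
    obtain rfl : j = 1 := by omega
    exact h.1

lemma exists_prev_of_good {p : X} (h : M.mirror.Good p) :
    ∃ y, ∃ j, 1 ≤ j ∧ j ≤ 2 ∧ (M.σ ^ j) y = p ∧ M.t y ∈ M.nbr (M.t p) ∧
      ∀ i < j, 1 ≤ i → M.kind (M.t ((M.σ ^ i) y)) = .A := by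
  rw [mirror_good] at h
  rcases h with h | h
  · exact ⟨_, 1, le_rfl, by norm_num, M.σ.apply_symm_apply p, h, by omega⟩
  · refine ⟨M.σ.symm (M.σ.symm p), 2, by norm_num, le_rfl, ?_, h.2, fun j hj hj' => ?_⟩
    · simp [pow_two]
    · obtain rfl : j = 1 := by omega
      simpa using h.1

lemma s_pow (n : ℕ) (x : X) : M.s ((M.σ ^ n) x) = M.s x := by
  induction n with
  | zero => rfl
  | succ n ih => rw [pow_succ', Equiv.Perm.mul_apply, M.s_σ, ih]

/-- An edge joining two vertices with two darts to `D` each is good at one side at most. -/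
lemma not_good_of_C2 {h : X} (hs : M.C2 (M.s h)) (ht : M.C2 (M.t h)) (h₁ : M.Good h)
    (h₂ : M.mirror.Good h) : False := by
  obtain ⟨i, hi1, hi2, hw, hi⟩ := exists_next_of_good h₁
  obtain ⟨y, j, hj1, hj2, rfl, hu, hj⟩ := exists_prev_of_good h₂
  rw [← Equiv.Perm.mul_apply, ← pow_add] at hw
  have hwD := (mem_nbr.1 hw).1
  have huD := (mem_nbr.1 hu).1
  have hwn : M.t ((M.σ ^ (i + j)) y) ∈ M.nbr (M.s ((M.σ ^ j) y)) := by
    have := t_mem_nbr hwD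
    rwa [s_pow, ← s_pow j] at this
  have hun : M.t y ∈ M.nbr (M.s ((M.σ ^ j) y)) := by
    have := t_mem_nbr huD
    rwa [← s_pow j] at this
  -- Both sides see common `D`-neighbours of the two ends. If these coincide, uniqueness of the dart
  -- closes the rotation within four steps, leaving no room for a second dart to `D`; if they
  -- differ, the ends share both `D`-neighbours and coincide.
  by_cases e : M.t ((M.σ ^ (i + j)) y) = M.t y
  · rw [s_pow] at hs
    have e' := hs.dart_unique huD (s_pow _ _) e
    obtain ⟨x, hx, hxD, hne⟩ := hs.exists_ne
    obtain ⟨n, hn, rfl⟩ := exists_pow_lt (k := i + j) (by omega) e' hx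
    have hn0 : n ≠ 0 := by rintro rfl; exact hne rfl
    rcases lt_trichotomy n j with h | rfl | h
    · have := hj n h (by omega)
      rw [this] at hxD
      simp at hxD
    · rw [ht.1] at hxD
      simp at hxD
    · have := hi (n - j) (by omega) (by omega)
      rw [← Equiv.Perm.mul_apply, ← pow_add, Nat.sub_add_cancel h.le] at this
      rw [this] at hxD
      simp at hxD
  · have := C2.eq_of_nbr hs ht e hwn hun hw hu
    exact M.t_ne_s _ this.symm

lemma card_C2_C3 :
    #{h | M.C2 (M.s h) ∧ M.C3 (M.t h)} = #{h | M.C3 (M.s h) ∧ M.C2 (M.t h)} := by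
  refine card_bij (fun h _ => M.r h) ?_ ?_ ?_
  · intro h hh
    rw [mem_filter_univ] at hh ⊢
    rw [t_r]
    exact ⟨hh.2, hh.1⟩
  · intro x _ y _ e
    exact M.r_inj e
  · intro h hh
    rw [mem_filter_univ] at hh
    refine ⟨M.r h, ?_, M.r_r h⟩
    rw [mem_filter_univ, t_r]
    exact ⟨hh.2, hh.1⟩

lemma not_C2_of_C3 {v : V} (h : M.C3 v) : ¬ M.C2 v := fun h' => h.2 h'.2

/-- Payment by the darts joining two vertices of `C`. -/
lemma card_CC_ge :
    #{h | M.C2 (M.s h) ∧ M.kind (M.t h) = .C ∧ M.mirror.Good h} +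
      #{h | M.C2 (M.s h) ∧ M.kind (M.t h) = .C ∧ M.Good h} +
      #{h | M.C3 (M.s h) ∧ M.C3 (M.t h)} ≤
      #{h | M.kind (M.s h) = .C ∧ M.kind (M.t h) = .C} := by
  have h1 := card_union_add_card_inter
    ({h | M.C2 (M.s h) ∧ M.kind (M.t h) = .C ∧ M.mirror.Good h} : Finset X)
    ({h | M.C2 (M.s h) ∧ M.kind (M.t h) = .C ∧ M.Good h} : Finset X)
  have h2 : #(({h | M.C2 (M.s h) ∧ M.kind (M.t h) = .C ∧ M.mirror.Good h} : Finset X) ∪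
      ({h | M.C2 (M.s h) ∧ M.kind (M.t h) = .C ∧ M.Good h} : Finset X)) ≤
      #{h | M.C2 (M.s h) ∧ M.kind (M.t h) = .C} := by
    refine card_le_card fun h hh => ?_
    simp only [mem_union, mem_filter_univ] at hh ⊢
    tauto
  -- A dart good on both sides ends in `C3`, so its reverse, going from `C3` to `C2`, can pay the
  -- second unit.
  have h3 : #(({h | M.C2 (M.s h) ∧ M.kind (M.t h) = .C ∧ M.mirror.Good h} : Finset X) ∩
      ({h | M.C2 (M.s h) ∧ M.kind (M.t h) = .C ∧ M.Good h} : Finset X)) ≤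
      #{h | M.C2 (M.s h) ∧ M.C3 (M.t h)} := by
    refine card_le_card fun h hh => ?_
    simp only [mem_inter, mem_filter_univ] at hh ⊢
    refine ⟨hh.1.1, (C_iff.1 hh.1.2.1).resolve_left fun h' => ?_⟩
    exact not_good_of_C2 hh.1.1 h' hh.2.2.2 hh.1.2.2
  have h4 : #{h | M.C2 (M.s h) ∧ M.kind (M.t h) = .C} + #{h | M.C3 (M.s h) ∧ M.kind (M.t h) = .C} =
      #{h | M.kind (M.s h) = .C ∧ M.kind (M.t h) = .C} := by
    rw [← card_union_of_disjoint]
    · congr 1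
      ext h
      simp only [mem_union, mem_filter_univ, C_iff (v := M.s h)]
      tauto
    · rw [disjoint_filter]
      exact fun h _ h1 h2 => not_C2_of_C3 h2.1 h1.1
  have h5 : #{h | M.C3 (M.s h) ∧ M.C2 (M.t h)} + #{h | M.C3 (M.s h) ∧ M.C3 (M.t h)} =
      #{h | M.C3 (M.s h) ∧ M.kind (M.t h) = .C} := by
    rw [← card_union_of_disjoint]
    · congr 1
      ext h
      simp only [mem_union, mem_filter_univ, C_iff (v := M.t h)]
      tauto
    · rw [disjoint_filter]
      exact fun h _ h1 h2 => not_C2_of_C3 h2.2 h1.2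
  have := card_C2_C3 (M := M)
  omega

end ColouredMap

/-! ### Payments by the vertices of `A` -/

namespace ColouredMap

variable {V X F : Type*} [Fintype V] [Fintype X] [Fintype F] {M : ColouredMap V X F}

lemma Saturated.mem_nbr_of_left (hM : M.Saturated) {p : X} (h : M.kind (M.t p) = .D)
    (h' : M.kind (M.t (M.σ p)) = .C) : M.t p ∈ M.nbr (M.t (M.σ p)) := by
  refine mem_nbr.2 ⟨h, M.φ (M.σ p), M.s_φ _, hM.t_φ_σ ?_ (by simp [h])⟩
  intro e
  rw [e, h'] at h
  simp at h

lemma Saturated.mem_nbr_of_right (hM : M.Saturated) {p : X} (h : M.kind (M.t p) = .C)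
    (h' : M.kind (M.t (M.σ p)) = .D) : M.t (M.σ p) ∈ M.nbr (M.t p) := by
  refine mem_nbr.2 ⟨h', M.r (M.φ (M.σ p)), hM.t_φ_σ ?_ (by simp [h]), ?_⟩
  · intro e
    rw [e, h'] at h
    simp at h
  · rw [t_r, M.s_φ]

lemma C2.three_le_deg {x : X} (h : M.C2 (M.t x)) (hx : M.kind (M.s x) = .A) :
    3 ≤ M.deg (M.t x) := by
  have hs : insert (M.r x) ({y | M.s y = M.t x ∧ M.kind (M.t y) = .D} : Finset X) ⊆
      ({y | M.s y = M.t x} : Finset X) := by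
    intro y hy
    rw [mem_insert, mem_filter_univ] at hy
    rw [mem_filter_univ]
    rcases hy with rfl | hy
    · rfl
    · exact hy.1
  have := card_le_card hs
  rw [card_insert_of_notMem, h.2] at this
  · exact this
  · rw [mem_filter_univ, t_r, hx]
    simp

/-- Around a vertex in `A` of degree four, vertices in `D` do not alternate with vertices with two
darts to `D`. -/
lemma Saturated.not_alternating (hM : M.Saturated) {p : X} (hA : M.kind (M.s p) = .A)
    (h4 : M.σ (M.σ (M.σ (M.σ p))) = p) (h₀ : M.kind (M.t p) = .D) (h₁ : M.C2 (M.t (M.σ p)))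
    (h₂ : M.kind (M.t (M.σ (M.σ p))) = .D) (h₃ : M.C2 (M.t (M.σ (M.σ (M.σ p))))) : False := by
  have n01 := hM.mem_nbr_of_left h₀ h₁.1
  have n12 := hM.mem_nbr_of_right h₁.1 h₂
  have n23 := hM.mem_nbr_of_left h₂ h₃.1
  have n30 := hM.mem_nbr_of_right h₃.1 (by rwa [h4])
  rw [h4] at n30
  -- If the two vertices of `D` coincide, a `C2`-vertex between them has degree at most two, in
  -- spite of its two darts to `D` and one to `A`. If not, the two `C2`-vertices coincide by
  -- `eq_of_nbr`, and the vertex of `D` between them has degree at most two.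
  by_cases e : M.t (M.σ (M.σ p)) = M.t p
  · have := hM.deg_le_two e (fun e' => by rw [e', h₁.1] at h₀; simp at h₀) (by simp [h₀])
      (by
        intro x y hx hx' hy hy'
        refine C2.dart_unique (by rwa [hy]) (by rwa [hy']) (by rw [hx, hy]) (by rw [hx', hy']))
    have := h₁.three_le_deg (by rwa [M.s_σ])
    omega
  · have e' := h₁.eq_of_nbr h₃ e n12 n01 n23 n30
    have := hM.deg_le_two e'.symm (fun e' => by rw [← e', h₁.1] at h₂; simp at h₂) (by simp [h₁.1])
      (by
        intro x y hx hx' hy hy'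
        refine C2.dart_unique' (by rwa [hy']) (by rwa [hy]) (by rw [hx, hy]) (by rw [hx', hy']))
    have := M.eleven_le_deg h₂
    omega

/-- The charge that a dart at a vertex of `A` has to pay, in terms of the types of the previous, the
present and the next target, where `0` stands for `D`, `1` for `C2` and `2` for `C3`. -/
def payment (x y z : Fin 3) : ℕ :=
  (if y = 1 ∧ z = 0 then 1 else 0) + (if y = 1 ∧ x = 0 then 1 else 0) +
    (if y = 0 ∧ z = 2 ∧ x = 2 then 1 else 0)

lemma payment_four : ∀ a b c d : Fin 3, ¬ (a = 0 ∧ b = 1 ∧ c = 0 ∧ d = 1) →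
    ¬ (b = 0 ∧ c = 1 ∧ d = 0 ∧ a = 1) →
    payment a b c + payment b c d + payment c d a + payment d a b ≤ 2 := by
  unfold payment
  decide

lemma payment_five : ∀ a b c d e : Fin 3,
    payment a b c + payment b c d + payment c d e + payment d e a + payment e a b ≤ 4 := by
  unfold payment
  decide

/-- Once the first summand is shifted cyclically by one index, the three conditions at each index
exclude one another. -/
lemma payment_sum_le (T : ℕ → Fin 3) (k : ℕ) (hT : ∀ i, T (i + k) = T i) :
    ∑ i ∈ range k, payment (T i) (T (i + 1)) (T (i + 2)) ≤ k := by
  have shift : ∑ i ∈ range k, (if T (i + 1) = 1 ∧ T (i + 2) = 0 then 1 else 0) =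
      ∑ i ∈ range k, if T i = 1 ∧ T (i + 1) = 0 then 1 else 0 := by
    have h1 := sum_range_succ (fun i => if T i = 1 ∧ T (i + 1) = 0 then 1 else 0) k
    have h2 := sum_range_succ' (fun i => if T i = 1 ∧ T (i + 1) = 0 then 1 else 0) k
    have e0 : T k = T 0 := by simpa using hT 0
    have e1 : T (k + 1) = T 1 := by rw [add_comm, hT]
    simp only [e0, e1, zero_add] at h1 h2
    rw [h1] at h2
    exact (Nat.add_right_cancel h2).symm
  unfold payment
  rw [sum_add_distrib, sum_add_distrib, shift, ← sum_add_distrib, ← sum_add_distrib]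
  have : ∀ i ∈ range k, ((if T i = 1 ∧ T (i + 1) = 0 then 1 else 0) +
      (if T (i + 1) = 1 ∧ T i = 0 then 1 else 0) +
      (if T (i + 1) = 0 ∧ T (i + 2) = 2 ∧ T i = 2 then 1 else 0)) ≤ 1 := by
    intro i _
    generalize T i = a
    generalize T (i + 1) = b
    generalize T (i + 2) = c
    revert a b c
    decide
  refine (sum_le_sum this).trans ?_
  simp

variable (M) in
/-- The type of a vertex outside `A`. -/
noncomputable def type (v : V) : Fin 3 := if M.C2 v then 1 else if M.C3 v then 2 else 0

lemma type_eq_zero {v : V} : M.type v = 0 ↔ M.kind v ≠ .C := by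
  unfold type
  rw [Ne, C_iff]
  split_ifs <;> simp [*]

lemma type_eq_one {v : V} : M.type v = 1 ↔ M.C2 v := by
  unfold type
  split_ifs <;> simp [*]

lemma type_eq_two {v : V} : M.type v = 2 ↔ M.C3 v := by
  unfold type
  split_ifs with h1 h2
  · simp only [Fin.reduceEq, false_iff]
    exact fun h => not_C2_of_C3 h h1
  · simp [*]
  · simp [*]

lemma kind_t_eq_D {x : X} (hx : M.kind (M.s x) = .A) :
    M.kind (M.t x) = .D ↔ M.type (M.t x) = 0 := by
  rw [type_eq_zero]
  have := M.indep x hx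
  change M.kind (M.t x) ≠ .A at this
  cases h : M.kind (M.t x) <;> simp_all

/-- For degree `k ≥ 6` the bound `k ≤ 2k - 6` suffices. Degrees 4 and 5 are finite checks, where
`not_alternating` removes the pattern excluded in `payment_four`. -/
lemma Saturated.sum_payment_le (hM : M.Saturated) {a : V} (ha : M.kind a = .A)
    (h4 : 4 ≤ M.deg a) :
    ∑ b ∈ ({b | M.s b = a} : Finset X), payment (M.type (M.t (M.σ.symm b))) (M.type (M.t b))
      (M.type (M.t (M.σ b))) ≤ 2 * M.deg a - 6 := by
  obtain ⟨x, hx⟩ : ({b | M.s b = a} : Finset X).Nonempty := by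
    rw [← card_pos]
    change 0 < M.deg a
    omega
  rw [mem_filter_univ] at hx
  subst hx
  set T : ℕ → Fin 3 := fun i => M.type (M.t ((M.σ ^ i) x)) with hTdef
  set k := M.deg (M.s x) with hk
  have hT : ∀ i, T (i + k) = T i := by
    intro i
    simp only [hTdef]
    rw [pow_add, Equiv.Perm.mul_apply, M.pow_deg]
  have hs : ∑ b ∈ ({b | M.s b = M.s x} : Finset X), payment (M.type (M.t (M.σ.symm b)))
      (M.type (M.t b)) (M.type (M.t (M.σ b))) =
      ∑ i ∈ range k, payment (T i) (T (i + 1)) (T (i + 2)) := by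
    have := M.sum_darts (M.σ x) (fun b => payment (M.type (M.t (M.σ.symm b))) (M.type (M.t b))
      (M.type (M.t (M.σ b))))
    rw [M.s_σ] at this
    rw [this]
    refine sum_congr rfl fun i _ => ?_
    have e1 : (M.σ ^ i) (M.σ x) = (M.σ ^ (i + 1)) x := by rw [pow_succ]; rfl
    have e2 : M.σ ((M.σ ^ (i + 1)) x) = (M.σ ^ (i + 2)) x := by rw [pow_succ' _ (i + 1)]; rfl
    have e3 : M.σ.symm ((M.σ ^ (i + 1)) x) = (M.σ ^ i) x := by
      rw [pow_succ']
      exact M.σ.symm_apply_apply _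
    rw [e1, e2, e3]
  rw [hs]
  have alt : ∀ i, k = 4 → ¬ (T i = 0 ∧ T (i + 1) = 1 ∧ T (i + 2) = 0 ∧ T (i + 3) = 1) := by
    rintro i hk4 ⟨h0, h1, h2, h3⟩
    have hsA : ∀ j, M.kind (M.s ((M.σ ^ j) x)) = .A := by
      intro j
      rw [M.s_pow, ha]
    have e1 : (M.σ ^ (i + 1)) x = M.σ ((M.σ ^ i) x) := by rw [pow_succ']; rfl
    have e2 : (M.σ ^ (i + 2)) x = M.σ (M.σ ((M.σ ^ i) x)) := by rw [pow_succ', pow_succ']; rfl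
    have e3 : (M.σ ^ (i + 3)) x = M.σ (M.σ (M.σ ((M.σ ^ i) x))) := by
      rw [pow_succ', pow_succ', pow_succ']; rfl
    refine hM.not_alternating (p := (M.σ ^ i) x) (hsA i) ?_ ((kind_t_eq_D (hsA i)).2 h0) ?_ ?_ ?_
    · have := M.pow_deg ((M.σ ^ i) x)
      rw [M.s_pow, ← hk, hk4] at this
      exact this
    · rw [← e1]
      exact type_eq_one.1 h1
    · rw [← e2]
      exact (kind_t_eq_D (hsA _)).2 h2
    · rw [← e3]
      exact type_eq_one.1 h3
  rcases lt_or_ge k 6 with h6 | h6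
  · obtain h | h : k = 4 ∨ k = 5 := by omega
    · have a0 := alt 0 h
      have a1 := alt 1 h
      have p0 := hT 0
      have p1 := hT 1
      rw [h] at p0 p1
      rw [h]
      norm_num [sum_range_succ] at a0 a1 p0 p1 ⊢
      rw [p0] at a1
      rw [p0, p1]
      exact payment_four _ _ _ _ (by tauto) (by tauto)
    · have p0 := hT 0
      have p1 := hT 1
      rw [h] at p0 p1
      rw [h]
      norm_num [sum_range_succ] at p0 p1 ⊢
      rw [p0, p1]
      exact payment_five _ _ _ _ _
  · refine (payment_sum_le T k hT).trans ?_
    omega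

/-- Payment by the vertices of `A`. -/
lemma Saturated.card_le_sum_A (hM : M.Saturated) :
    #{b | M.kind (M.s b) = .A ∧ 4 ≤ M.deg (M.s b) ∧ M.C2 (M.t b) ∧ M.kind (M.t (M.σ b)) = .D} +
      #{b | M.kind (M.s b) = .A ∧ 4 ≤ M.deg (M.s b) ∧ M.C2 (M.t b) ∧
        M.kind (M.t (M.σ.symm b)) = .D} +
      #{b | M.kind (M.s b) = .A ∧ 4 ≤ M.deg (M.s b) ∧ M.kind (M.t b) = .D ∧ M.C3 (M.t (M.σ b)) ∧
        M.C3 (M.t (M.σ.symm b))} ≤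
      ∑ v with M.kind v = .A, (2 * M.deg v - 6) := by
  simp only [card_filter]
  rw [← sum_add_distrib, ← sum_add_distrib, ← sum_fiberwise _ M.s, sum_filter]
  refine sum_le_sum fun v _ => ?_
  split_ifs with hv
  · by_cases h4 : 4 ≤ M.deg v
    · refine le_trans (le_of_eq (sum_congr rfl fun b hb => ?_)) (hM.sum_payment_le hv h4)
      rw [mem_filter_univ] at hb
      have hA : M.kind (M.s b) = .A := by rw [hb, hv]
      have hA1 : M.kind (M.s (M.σ b)) = .A := by rw [M.s_σ, hA]
      have hA2 : M.kind (M.s (M.σ.symm b)) = .A := by rw [M.s_σ_symm, hA]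
      simp only [payment, hv, kind_t_eq_D hA, kind_t_eq_D hA1, kind_t_eq_D hA2, type_eq_one,
        type_eq_two, true_and, hb, h4]
    · rw [sum_eq_zero]
      · exact Nat.zero_le _
      · intro b hb
        rw [mem_filter_univ] at hb
        simp [hb, h4]
  · rw [sum_eq_zero]
    intro b hb
    rw [mem_filter_univ] at hb
    simp [hb, hv]

end ColouredMap

/-! ### Payments by large faces, and consecutive vertices of `C3` -/

namespace ColouredMap

variable {V X F : Type*} [Fintype V] [Fintype X] [Fintype F] {M : ColouredMap V X F}

variable (M) in
/-- The corners to which large faces pay. -/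
def PaidCorner (p : X) : Prop :=
  (M.kind (M.s p) = .D ∧ M.kind (M.t p) = .A ∧ M.kind (M.t (M.σ p)) = .A) ∨
    (M.kind (M.s p) = .D ∧ M.C3 (M.t p) ∧ M.t p = M.t (M.σ p)) ∨
    (M.kind (M.s p) = .A ∧ M.C3 (M.t p) ∧ M.t p = M.t (M.σ p))

lemma card_large_le :
    #{x | 4 ≤ M.len (M.face x)} ≤ 2 * ∑ f, (2 * M.len f - 6) := by
  rw [card_eq_sum_card_fiberwise (f := M.face) (t := univ) (by simp), mul_sum]
  refine sum_le_sum fun f _ => ?_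
  rw [filter_filter]
  by_cases h : 4 ≤ M.len f
  · have : #{x | 4 ≤ M.len (M.face x) ∧ M.face x = f} ≤ M.len f := by
      refine card_le_card fun x hx => ?_
      rw [mem_filter_univ] at hx ⊢
      exact hx.2
    omega
  · rw [card_eq_zero.2]
    · exact Nat.zero_le _
    · rw [filter_eq_empty_iff]
      rintro x - ⟨h', rfl⟩
      exact h h'

lemma PaidCorner.four_le_len {p : X} (h : M.PaidCorner p) : 4 ≤ M.len (M.face (M.σ p)) := by
  apply ColouredMap.four_le_len
  rcases h with h | h | h
  · exact .inr h.2
  · exact .inl h.2.2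
  · exact .inl h.2.2

/-- A paid corner `p` uses the darts `r p` and `σ p` of its face. Consecutive corners are never both
paid, because the source of each is a target of the other and the classes do not match. So a face of
length `l ≥ 4` pays at most `l / 2 ≤ 2l - 6`. -/
lemma card_paidCorner_le : #{p | M.PaidCorner p} ≤ ∑ f, (2 * M.len f - 6) := by
  have hd : Disjoint (({p | M.PaidCorner p} : Finset X).image M.σ)
      (({p | M.PaidCorner p} : Finset X).image M.r) := by
    rw [disjoint_left]
    intro x hx hx'
    rw [mem_image] at hx hx'
    obtain ⟨p, hp, rfl⟩ := hx
    obtain ⟨q, hq, e⟩ := hx'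
    rw [mem_filter_univ] at hp hq
    have e1 : M.t q = M.s p := by rw [← M.s_σ p, ← e]; rfl
    have e2 : M.t (M.σ p) = M.s q := by rw [← e, t_r]
    unfold PaidCorner C3 at hp hq
    rw [e2] at hp
    rw [e1] at hq
    rcases hp with ⟨h1, h2, h3⟩ | ⟨h1, h2, h3⟩ | ⟨h1, h2, h3⟩ <;>
    rcases hq with ⟨g1, g2, g3⟩ | ⟨g1, g2, g3⟩ | ⟨g1, g2, g3⟩ <;> simp_all
  have hs : (({p | M.PaidCorner p} : Finset X).image M.σ) ∪
      (({p | M.PaidCorner p} : Finset X).image M.r) ⊆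
      ({x | 4 ≤ M.len (M.face x)} : Finset X) := by
    intro x hx
    rw [mem_union, mem_image, mem_image] at hx
    rw [mem_filter_univ]
    rcases hx with ⟨p, hp, rfl⟩ | ⟨p, hp, rfl⟩ <;> rw [mem_filter_univ] at hp
    · exact hp.four_le_len
    · have := hp.four_le_len
      rwa [← M.face_φ, φ, M.r_r]
  have := card_le_card hs
  rw [card_union_of_disjoint hd, card_image_of_injective _ M.σ.injective,
    card_image_of_injective _ fun _ _ => M.r_inj] at this
  have := card_large_le (M := M)
  omega

lemma kind_ne_of_C3 {v : V} (h : M.C3 v) : M.kind v ≠ .A := by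
  rw [h.1]
  simp

/-- The corner is a triangle, and its far side pays. The class of the apex `t (φ z)` separates this
from the payments in `card_CAC_ne_le`. -/
lemma Saturated.card_CC_triangle_le (hM : M.Saturated) :
    #{p | M.kind (M.s p) = .D ∧ M.C3 (M.t p) ∧ M.C3 (M.t (M.σ p)) ∧ M.t p ≠ M.t (M.σ p)} ≤
      #{z | M.C3 (M.s z) ∧ M.C3 (M.t z) ∧ M.kind (M.t (M.φ z)) = .D} := by
  refine card_le_card_of_injOn (fun p => M.φ (M.σ p)) ?_ ?_
  · intro p hp
    rw [mem_coe, mem_filter_univ] at hp ⊢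
    obtain ⟨h1, h2, h3, h4⟩ := hp
    have hA : M.kind (M.t p) = .A → M.kind (M.t (M.σ p)) ≠ .A := fun _ => kind_ne_of_C3 h3
    rw [M.s_φ, hM.t_φ_σ h4 hA, φ, hM.σ_r_φ h4 hA, t_r]
    exact ⟨h3, h2, h1⟩
  · intro p _ q _ h
    exact M.σ.injective (M.φ_inj h)

section

variable {p : X}

lemma ne_of_C3_of_A {v w : V} (h : M.C3 v) (h' : M.kind w = .A) : v ≠ w := by
  rintro rfl
  exact kind_ne_of_C3 h h'

lemma Saturated.corner_left (hM : M.Saturated) (hC : M.C3 (M.t p))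
    (hA : M.kind (M.t (M.σ p)) = .A) :
    M.σ (M.r (M.φ (M.σ p))) = M.r p ∧ M.t (M.φ (M.σ p)) = M.t p :=
  have h : M.kind (M.t p) = .A → M.kind (M.t (M.σ p)) ≠ .A := fun h => absurd h (kind_ne_of_C3 hC)
  ⟨hM.σ_r_φ (ne_of_C3_of_A hC hA) h, hM.t_φ_σ (ne_of_C3_of_A hC hA) h⟩

lemma Saturated.corner_right (hM : M.Saturated) (hA : M.kind (M.t p) = .A)
    (hC : M.C3 (M.t (M.σ p))) :
    M.σ (M.r (M.φ (M.σ p))) = M.r p ∧ M.t (M.φ (M.σ p)) = M.t p :=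
  have h : M.kind (M.t p) = .A → M.kind (M.t (M.σ p)) ≠ .A := fun _ => kind_ne_of_C3 hC
  ⟨hM.σ_r_φ (ne_of_C3_of_A hC hA).symm h, hM.t_φ_σ (ne_of_C3_of_A hC hA).symm h⟩

/-- The third corner at a vertex of degree three in `A`. -/
lemma Saturated.σ_φ_σ (hM : M.Saturated) (hA : M.kind (M.t (M.σ p)) = .A)
    (hC' : M.C3 (M.t (M.σ (M.σ p))))
    (h3 : M.deg (M.t (M.σ p)) = 3) :
    M.t (M.σ (M.φ (M.σ p))) = M.t (M.σ (M.σ p)) := by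
  obtain ⟨h1, h2⟩ := hM.corner_right hA hC'
  have e : M.s (M.r (M.φ (M.σ (M.σ p)))) = M.t (M.σ p) := h2
  have := σ_σ_σ (p := M.r (M.φ (M.σ (M.σ p)))) (by rw [e, h3])
  rw [h1] at this
  change M.σ (M.φ (M.σ p)) = _ at this
  rw [this, t_r, M.s_φ]

/-- The dart from the vertex of `A` back to `D` pays: both corners beside it are triangles, so its
neighbours in the rotation lead to the two `C3`-vertices. -/
lemma Saturated.card_CAC_four_le (hM : M.Saturated) :
    #{p | M.kind (M.s p) = .D ∧ M.C3 (M.t p) ∧ M.kind (M.t (M.σ p)) = .A ∧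
      M.C3 (M.t (M.σ (M.σ p))) ∧ 4 ≤ M.deg (M.t (M.σ p))} ≤
      #{b | M.kind (M.s b) = .A ∧ 4 ≤ M.deg (M.s b) ∧ M.kind (M.t b) = .D ∧ M.C3 (M.t (M.σ b)) ∧
        M.C3 (M.t (M.σ.symm b))} := by
  refine card_le_card_of_injOn (fun p => M.r (M.σ p)) ?_ ?_
  · intro p hp
    rw [mem_coe, mem_filter_univ] at hp ⊢
    obtain ⟨h1, h2, h3, h4, h5⟩ := hp
    have hl := hM.corner_left h2 h3
    have hr := hM.corner_right h3 h4
    rw [s_r', t_r, M.s_σ]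
    refine ⟨h3, h5, h1, ?_, ?_⟩
    · change M.C3 (M.t (M.φ (M.σ p)))
      rwa [hl.2]
    · beta_reduce
      rw [← hr.1, Equiv.symm_apply_apply, t_r, M.s_φ]
      exact h4
  · intro p _ q _ h
    exact M.σ.injective (M.r_inj h)

/-- At a vertex of `A` of degree three, the third corner lies between the two `C3`-vertices; when
these are equal, it is a corner paid by a large face. -/
lemma Saturated.card_CAC_eq_le (hM : M.Saturated) :
    #{p | M.C3 (M.t p) ∧ M.kind (M.t (M.σ p)) = .A ∧
      M.C3 (M.t (M.σ (M.σ p))) ∧ M.deg (M.t (M.σ p)) = 3 ∧ M.t p = M.t (M.σ (M.σ p))} ≤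
      #{p | M.kind (M.s p) = .A ∧ M.C3 (M.t p) ∧ M.t p = M.t (M.σ p)} := by
  refine card_le_card_of_injOn (fun p => M.φ (M.σ p)) ?_ ?_
  · intro p hp
    rw [mem_coe, mem_filter_univ] at hp ⊢
    obtain ⟨h2, h3, h4, h5, h6⟩ := hp
    rw [M.s_φ, (hM.corner_left h2 h3).2, hM.σ_φ_σ h3 h4 h5]
    exact ⟨h3, h2, h6⟩
  · intro p _ q _ h
    exact M.σ.injective (M.φ_inj h)

/-- Now the third corner at the vertex of `A` is a triangle, and its far side joins the two
`C3`-vertices. -/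
lemma Saturated.card_CAC_ne_le (hM : M.Saturated) :
    #{p | M.C3 (M.t p) ∧ M.kind (M.t (M.σ p)) = .A ∧
      M.C3 (M.t (M.σ (M.σ p))) ∧ M.deg (M.t (M.σ p)) = 3 ∧ M.t p ≠ M.t (M.σ (M.σ p))} ≤
      #{z | M.C3 (M.s z) ∧ M.C3 (M.t z) ∧ M.kind (M.t (M.φ z)) = .A} := by
  refine card_le_card_of_injOn (fun p => M.φ (M.σ (M.φ (M.σ p)))) ?_ ?_
  · intro p hp
    rw [mem_coe, mem_filter_univ] at hp ⊢
    obtain ⟨h2, h3, h4, h5, h6⟩ := hp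
    have hl := hM.corner_left h2 h3
    have hσ := hM.σ_φ_σ h3 h4 h5
    have hne : M.t (M.φ (M.σ p)) ≠ M.t (M.σ (M.φ (M.σ p))) := by rwa [hl.2, hσ]
    have hA : M.kind (M.t (M.φ (M.σ p))) = .A → M.kind (M.t (M.σ (M.φ (M.σ p)))) ≠ .A := by
      rw [hσ]
      exact fun _ => kind_ne_of_C3 h4
    rw [M.s_φ, hσ, hM.t_φ_σ hne hA, hl.2]
    refine ⟨h4, h2, ?_⟩
    rw [φ, hM.σ_r_φ hne hA, t_r, M.s_φ, h3]
  · intro p _ q _ h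
    exact M.σ.injective (M.φ_inj (M.σ.injective (M.φ_inj h)))

end

/-- Payment for the corners at vertices of `D` between two vertices of `A` and for the occurrences
of two consecutive vertices with more than two darts to `D`. -/
lemma Saturated.card_events_le (hM : M.Saturated) :
    #{p | M.kind (M.s p) = .D ∧ M.kind (M.t p) = .A ∧ M.kind (M.t (M.σ p)) = .A} +
      #{p | M.kind (M.s p) = .D ∧ M.C3 (M.t p) ∧ (M.C3 (M.t (M.σ p)) ∨
        M.kind (M.t (M.σ p)) = .A ∧ M.C3 (M.t (M.σ (M.σ p))))} ≤
      ∑ f, (2 * M.len f - 6) + #{z | M.C3 (M.s z) ∧ M.C3 (M.t z)} +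
        #{b | M.kind (M.s b) = .A ∧ 4 ≤ M.deg (M.s b) ∧ M.kind (M.t b) = .D ∧
          M.C3 (M.t (M.σ b)) ∧ M.C3 (M.t (M.σ.symm b))} := by
  have hsub : ({p | M.kind (M.s p) = .D ∧ M.C3 (M.t p) ∧ (M.C3 (M.t (M.σ p)) ∨
        M.kind (M.t (M.σ p)) = .A ∧ M.C3 (M.t (M.σ (M.σ p))))} : Finset X) ⊆
      ({p | M.kind (M.s p) = .D ∧ M.C3 (M.t p) ∧ M.t p = M.t (M.σ p)} : Finset X) ∪
      (({p | M.kind (M.s p) = .D ∧ M.C3 (M.t p) ∧ M.C3 (M.t (M.σ p)) ∧ M.t p ≠ M.t (M.σ p)} :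
        Finset X) ∪
      (({p | M.kind (M.s p) = .D ∧ M.C3 (M.t p) ∧ M.kind (M.t (M.σ p)) = .A ∧
        M.C3 (M.t (M.σ (M.σ p))) ∧ 4 ≤ M.deg (M.t (M.σ p))} : Finset X) ∪
      (({p | M.C3 (M.t p) ∧ M.kind (M.t (M.σ p)) = .A ∧
        M.C3 (M.t (M.σ (M.σ p))) ∧ M.deg (M.t (M.σ p)) = 3 ∧ M.t p = M.t (M.σ (M.σ p))} :
        Finset X) ∪
      ({p | M.C3 (M.t p) ∧ M.kind (M.t (M.σ p)) = .A ∧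
        M.C3 (M.t (M.σ (M.σ p))) ∧ M.deg (M.t (M.σ p)) = 3 ∧ M.t p ≠ M.t (M.σ (M.σ p))} :
        Finset X)))) := by
    intro p hp
    simp only [mem_union, mem_filter_univ] at hp ⊢
    obtain ⟨h1, h2, h3 | h3⟩ := hp
    · by_cases e : M.t p = M.t (M.σ p)
      · exact .inl ⟨h1, h2, e⟩
      · exact .inr (.inl ⟨h1, h2, h3, e⟩)
    · have h3' := M.three_le_deg' h3.1
      by_cases h4 : 4 ≤ M.deg (M.t (M.σ p))
      · exact .inr (.inr (.inl ⟨h1, h2, h3.1, h3.2, h4⟩))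
      · have h3'' : M.deg (M.t (M.σ p)) = 3 := by omega
        by_cases e : M.t p = M.t (M.σ (M.σ p))
        · exact .inr (.inr (.inr (.inl ⟨h2, h3.1, h3.2, h3'', e⟩)))
        · exact .inr (.inr (.inr (.inr ⟨h2, h3.1, h3.2, h3'', e⟩)))
  have h0 := (card_le_card hsub).trans ((card_union_le _ _).trans (Nat.add_le_add_left
    ((card_union_le _ _).trans (Nat.add_le_add_left ((card_union_le _ _).trans
      (Nat.add_le_add_left (card_union_le _ _) _)) _)) _))
  have h1 := hM.card_CC_triangle_le
  have h2 := hM.card_CAC_four_le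
  have h3 := hM.card_CAC_eq_le
  have h4 := hM.card_CAC_ne_le
  have h5 := card_paidCorner_le (M := M)
  have h6 : #{z | M.C3 (M.s z) ∧ M.C3 (M.t z) ∧ M.kind (M.t (M.φ z)) = .D} +
      #{z | M.C3 (M.s z) ∧ M.C3 (M.t z) ∧ M.kind (M.t (M.φ z)) = .A} ≤
      #{z | M.C3 (M.s z) ∧ M.C3 (M.t z)} := by
    rw [← card_union_of_disjoint]
    · refine card_le_card fun z hz => ?_
      simp only [mem_union, mem_filter_univ] at hz ⊢
      tauto
    · rw [disjoint_filter]
      intro z _ h h'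
      rw [h.2.2] at h'
      simp at h'
  have h7 : #{p | M.kind (M.s p) = .D ∧ M.kind (M.t p) = .A ∧ M.kind (M.t (M.σ p)) = .A} +
      (#{p | M.kind (M.s p) = .D ∧ M.C3 (M.t p) ∧ M.t p = M.t (M.σ p)} +
      #{p | M.kind (M.s p) = .A ∧ M.C3 (M.t p) ∧ M.t p = M.t (M.σ p)}) =
      #{p | M.PaidCorner p} := by
    rw [← card_union_of_disjoint, ← card_union_of_disjoint]
    · congr 1
      ext p
      simp only [mem_union, mem_filter_univ]
      rfl
    · rw [disjoint_left]
      intro p hp hp'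
      simp only [mem_union, mem_filter_univ] at hp hp'
      rcases hp' with hp' | hp'
      · exact kind_ne_of_C3 hp'.2.1 hp.2.1
      · exact kind_ne_of_C3 hp'.2.1 hp.2.1
    · rw [disjoint_filter]
      intro z _ h h'
      rw [h.1] at h'
      simp at h'
  omega

end ColouredMap

/-! ### The local count at a vertex of `D` -/

namespace ColouredMap

variable {V X F : Type*} [Fintype V] [Fintype X] [Fintype F] {M : ColouredMap V X F}

variable (M) in
/-- The next dart, disregarding one dart to `A`. -/
noncomputable def next (p : X) : X :=
  if M.kind (M.t (M.σ p)) = .A then M.σ (M.σ p) else M.σ p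

lemma s_next (p : X) : M.s (M.next p) = M.s p := by
  unfold next
  split_ifs <;> simp [M.s_σ]

lemma Good.next {p : X} (h : M.Good p) : M.t (M.next p) ∈ M.nbr (M.t p) := by
  unfold ColouredMap.next
  rcases h with h | h
  · rwa [if_neg]
    rw [(mem_nbr.1 h).1]
    simp
  · rw [if_pos h.1]
    exact h.2

lemma next_inj {p q : X} (hp : M.kind (M.t p) ≠ .A) (hq : M.kind (M.t q) ≠ .A)
    (h : M.next p = M.next q) : p = q := by
  unfold next at h
  split_ifs at h with h1 h2 h2
  · exact M.σ.injective (M.σ.injective h)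
  · have := M.σ.injective h
    rw [this] at h1
    exact absurd h1 hq
  · have := M.σ.injective h
    rw [← this] at h2
    exact absurd h2 hp
  · exact M.σ.injective h

lemma card_A_le (u : V) :
    #{x | M.s x = u ∧ M.kind (M.t x) = .A} ≤ #{x | M.s x = u ∧ M.kind (M.t x) ≠ .A} +
      #{p | M.s p = u ∧ M.kind (M.t p) = .A ∧ M.kind (M.t (M.σ p)) = .A} := by
  rw [← card_filter_add_card_filter_not (s := ({x | M.s x = u ∧ M.kind (M.t x) = .A} : Finset X))
    (fun x => M.kind (M.t (M.σ x)) = .A), add_comm]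
  refine add_le_add ?_ ?_
  · refine card_le_card_of_injOn M.σ ?_ M.σ.injective.injOn
    intro x hx
    simp only [coe_filter, mem_filter_univ, Set.mem_ofPred_eq] at hx
    rw [mem_coe, mem_filter_univ, M.s_σ]
    exact ⟨hx.1.1, hx.2⟩
  · refine card_le_card fun x hx => ?_
    simp only [mem_filter, mem_univ, true_and] at hx ⊢
    tauto

lemma C2.kind_ne {v : V} (h : M.C2 v) : M.kind v ≠ .A := by
  rw [h.1]
  simp

lemma kind_ne_of_mem_nbr {v w : V} (h : w ∈ M.nbr v) : M.kind w ≠ .A := by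
  rw [(mem_nbr.1 h).1]
  simp

/-- Each good side is assigned the dart to `D` that it sees. A dart seen from both sides belongs to
two `C2`-vertices with the same two `D`-neighbours, hence to one dart `p`; then the rotation at `u`
closes within four steps, although `u` has degree at least 11. -/
lemma card_good_le (u : V) (hu : M.kind u = .D) :
    #{p | M.s p = u ∧ M.C2 (M.t p) ∧ M.Good p} + #{p | M.s p = u ∧ M.C2 (M.t p) ∧ M.mirror.Good p} ≤
      #{x | M.s x = u ∧ M.kind (M.t x) = .D} := by
  set S : Finset X := {p | M.s p = u ∧ M.C2 (M.t p) ∧ M.Good p} with hS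
  set S' : Finset X := {p | M.s p = u ∧ M.C2 (M.t p) ∧ M.mirror.Good p} with hS'
  have h1 : #(S.image M.next) = #S := by
    refine card_image_of_injOn fun p hp q hq h => ?_
    rw [mem_coe, mem_filter_univ] at hp hq
    exact next_inj hp.2.1.kind_ne hq.2.1.kind_ne h
  have h2 : #(S'.image M.mirror.next) = #S' := by
    refine card_image_of_injOn fun p hp q hq h => ?_
    rw [mem_coe, mem_filter_univ] at hp hq
    exact next_inj (M := M.mirror) hp.2.1.kind_ne hq.2.1.kind_ne h
  have hd : Disjoint (S.image M.next) (S'.image M.mirror.next) := by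
    rw [disjoint_left]
    intro y hy hy'
    rw [mem_image] at hy hy'
    obtain ⟨p, hp, rfl⟩ := hy
    obtain ⟨q, hq, e⟩ := hy'
    rw [mem_filter_univ] at hp hq
    obtain ⟨hp1, hp2, hp3⟩ := hp
    obtain ⟨hq1, hq2, hq3⟩ := hq
    have np := hp3.next
    have nq : M.t (M.mirror.next q) ∈ M.nbr (M.t q) := hq3.next
    rw [e] at nq
    have hne : u ≠ M.t (M.next p) := by
      rw [← hp1, ← s_next p]
      exact (M.t_ne_s _).symm
    have e' := C2.eq_of_nbr hp2 hq2 hne (mem_nbr.2 ⟨hu, M.r p, rfl, by rw [t_r, hp1]⟩) np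
      (mem_nbr.2 ⟨hu, M.r q, rfl, by rw [t_r, hq1]⟩) nq
    have e'' : q = p := C2.dart_unique' hp2 (by rw [hp1, hu]) (by rw [hp1, hq1]) e'.symm
    rw [e''] at e
    have h11 := M.eleven_le_deg hu
    rw [← hp1] at h11
    have key : ∃ k, 0 < k ∧ k ≤ 4 ∧ ∃ x, M.s x = M.s p ∧ (M.σ ^ k) x = x := by
      unfold next at e
      change (if M.kind (M.t (M.σ.symm p)) = .A then M.σ.symm (M.σ.symm p) else M.σ.symm p) = _ at e
      split_ifs at e with g1 g2 g2
      · refine ⟨4, by norm_num, le_rfl, M.σ.symm (M.σ.symm p), by simp [s_σ_symm], ?_⟩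
        change M.σ (M.σ (M.σ (M.σ _))) = _
        rw [Equiv.apply_symm_apply, Equiv.apply_symm_apply, e]
      · refine ⟨3, by norm_num, by norm_num, M.σ.symm (M.σ.symm p), by simp [s_σ_symm], ?_⟩
        change M.σ (M.σ (M.σ _)) = _
        rw [Equiv.apply_symm_apply, Equiv.apply_symm_apply, e]
      · refine ⟨3, by norm_num, by norm_num, M.σ.symm p, by simp [s_σ_symm], ?_⟩
        change M.σ (M.σ (M.σ _)) = _
        rw [Equiv.apply_symm_apply, e]
      · refine ⟨2, by norm_num, by norm_num, M.σ.symm p, by simp [s_σ_symm], ?_⟩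
        change M.σ (M.σ _) = _
        rw [Equiv.apply_symm_apply, e]
    obtain ⟨k, hk, hk4, x, hx, hxk⟩ := key
    have := M.deg_le hk hxk
    rw [hx] at this
    omega
  rw [← h1, ← h2, ← card_union_of_disjoint hd]
  refine card_le_card fun y hy => ?_
  rw [mem_union, mem_image, mem_image] at hy
  rw [mem_filter_univ]
  rcases hy with ⟨p, hp, rfl⟩ | ⟨p, hp, rfl⟩ <;> rw [mem_filter_univ] at hp
  · exact ⟨by rw [s_next, hp.1], (mem_nbr.1 hp.2.2.next).1⟩
  · exact ⟨(s_next (M := M.mirror) p).trans hp.1, (mem_nbr.1 (Good.next (M := M.mirror) hp.2.2)).1⟩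

/-- Apart from the defects, a dart to `C3` is charged to its `next` dart, which goes to `D` or `C2`;
a dart good for `M` is charged to its `next` dart, which goes to `D`; a dart good for `M.mirror` is
charged to itself. The last is preceded by a dart to `D`, not to `C3`, so no dart is charged twice.
-/
lemma card_C3_le (u : V) :
    #{p | M.s p = u ∧ M.C3 (M.t p)} + #{p | M.s p = u ∧ M.C2 (M.t p) ∧ M.Good p} +
      #{p | M.s p = u ∧ M.C2 (M.t p) ∧ M.mirror.Good p} ≤
      #{x | M.s x = u ∧ (M.kind (M.t x) = .D ∨ M.C2 (M.t x))} +
      #{p | M.s p = u ∧ M.kind (M.t p) = .A ∧ M.kind (M.t (M.σ p)) = .A} +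
      #{p | M.s p = u ∧ M.C3 (M.t p) ∧ (M.C3 (M.t (M.σ p)) ∨
        M.kind (M.t (M.σ p)) = .A ∧ M.C3 (M.t (M.σ (M.σ p))))} := by
  set S : Finset X := {p | M.s p = u ∧ M.C3 (M.t p) ∧
    (M.kind (M.t (M.next p)) = .D ∨ M.C2 (M.t (M.next p)))} with hS
  set S₁ : Finset X := {p | M.s p = u ∧ M.C2 (M.t p) ∧ M.Good p} with hS₁
  set S₂ : Finset X := {p | M.s p = u ∧ M.C2 (M.t p) ∧ M.mirror.Good p} with hS₂
  have h1 : #{p | M.s p = u ∧ M.C3 (M.t p)} ≤ #S +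
      #{p | M.s p = u ∧ M.kind (M.t p) = .A ∧ M.kind (M.t (M.σ p)) = .A} +
      #{p | M.s p = u ∧ M.C3 (M.t p) ∧ (M.C3 (M.t (M.σ p)) ∨
        M.kind (M.t (M.σ p)) = .A ∧ M.C3 (M.t (M.σ (M.σ p))))} := by
    have h : #{p | M.s p = u ∧ M.C3 (M.t p) ∧ M.kind (M.t (M.σ p)) = .A ∧
        M.kind (M.t (M.σ (M.σ p))) = .A} ≤
        #{p | M.s p = u ∧ M.kind (M.t p) = .A ∧ M.kind (M.t (M.σ p)) = .A} := by
      refine card_le_card_of_injOn M.σ (fun p hp => ?_) M.σ.injective.injOn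
      rw [mem_coe, mem_filter_univ] at hp ⊢
      rw [M.s_σ]
      exact ⟨hp.1, hp.2.2⟩
    refine le_trans ?_ (Nat.add_le_add_right (Nat.add_le_add_left h _) _)
    refine le_trans (card_le_card ?_) ((card_union_le _ _).trans
      (Nat.add_le_add_right (card_union_le _ _) _))
    intro p hp
    simp only [mem_union, mem_filter_univ, hS] at hp ⊢
    obtain ⟨hp1, hp2⟩ := hp
    by_cases hA : M.kind (M.t (M.σ p)) = .A
    · rw [next, if_pos hA]
      cases hk : M.kind (M.t (M.σ (M.σ p))) with
      | A => exact .inl (.inr ⟨hp1, hp2, hA, rfl⟩)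
      | D => exact .inl (.inl ⟨hp1, hp2, .inl rfl⟩)
      | C =>
        rcases C_iff.1 hk with h' | h'
        · exact .inl (.inl ⟨hp1, hp2, .inr h'⟩)
        · exact .inr ⟨hp1, hp2, .inr ⟨hA, h'⟩⟩
    · rw [next, if_neg hA]
      cases hk : M.kind (M.t (M.σ p)) with
      | A => exact absurd hk hA
      | D => exact .inl (.inl ⟨hp1, hp2, .inl rfl⟩)
      | C =>
        rcases C_iff.1 hk with h' | h'
        · exact .inl (.inl ⟨hp1, hp2, .inr h'⟩)
        · exact .inr ⟨hp1, hp2, .inl h'⟩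
  have hd₁ : Disjoint S S₁ := by
    rw [disjoint_filter]
    exact fun p _ h h' => not_C2_of_C3 h.2.1 h'.2.1
  have h2 : #((S ∪ S₁).image M.next) = #S + #S₁ := by
    rw [← card_union_of_disjoint hd₁]
    refine card_image_of_injOn fun p hp q hq h => ?_
    have key : ∀ p ∈ (S ∪ S₁ : Finset X), M.kind (M.t p) ≠ .A := by
      intro p hp
      simp only [mem_union, mem_filter_univ, hS, hS₁] at hp
      rcases hp with hp | hp
      · exact kind_ne_of_C3 hp.2.1
      · exact hp.2.1.kind_ne
    exact next_inj (key p hp) (key q hq) h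
  have hd₂ : Disjoint ((S ∪ S₁).image M.next) S₂ := by
    rw [disjoint_left]
    intro q hq hq₂
    obtain ⟨p, hp, rfl⟩ := mem_image.1 hq
    rw [mem_union, mem_filter_univ, mem_filter_univ] at hp
    rw [mem_filter_univ] at hq₂
    rcases hp with ⟨-, hp, -⟩ | ⟨-, -, hp⟩
    · have hg := hq₂.2.2
      rw [mirror_good] at hg
      unfold next at hg
      split_ifs at hg with hA
      · rw [Equiv.symm_apply_apply, Equiv.symm_apply_apply] at hg
        rcases hg with hg | hg
        · exact kind_ne_of_mem_nbr hg hA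
        · have := (mem_nbr.1 hg.2).1
          rw [hp.1] at this
          simp at this
      · rw [Equiv.symm_apply_apply] at hg
        rcases hg with hg | hg
        · have := (mem_nbr.1 hg).1
          rw [hp.1] at this
          simp at this
        · exact kind_ne_of_C3 hp hg.1
    · have h := (mem_nbr.1 hp.next).1
      rw [hq₂.2.1.1] at h
      simp at h
  have h3 : #S + #S₁ + #S₂ ≤ #{x | M.s x = u ∧ (M.kind (M.t x) = .D ∨ M.C2 (M.t x))} := by
    rw [← h2, ← card_union_of_disjoint hd₂]
    refine card_le_card fun y hy => ?_
    rw [mem_union, mem_image] at hy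
    rw [mem_filter_univ]
    rcases hy with ⟨p, hp, rfl⟩ | hy
    · rw [mem_union, mem_filter_univ, mem_filter_univ] at hp
      rcases hp with hp | hp
      · exact ⟨by rw [s_next, hp.1], hp.2.2⟩
      · exact ⟨by rw [s_next, hp.1], .inl (mem_nbr.1 hp.2.2.next).1⟩
    · rw [mem_filter_univ] at hy
      exact ⟨hy.1, .inr hy.2.1⟩
  omega

/-- The final charge of a vertex in `D` is not positive. -/
lemma charge_le (u : V) (hu : M.kind u = .D) :
    6 + #{p | M.s p = u ∧ M.C2 (M.t p)} ≤ #{p | M.s p = u ∧ M.kind (M.t p) = .D} +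
      #{p | M.s p = u ∧ M.C2 (M.t p) ∧ ¬ M.Good p} +
      #{p | M.s p = u ∧ M.C2 (M.t p) ∧ ¬ M.mirror.Good p} +
      #{p | M.s p = u ∧ M.kind (M.t p) = .A ∧ M.kind (M.t (M.σ p)) = .A} +
      #{p | M.s p = u ∧ M.C3 (M.t p) ∧ (M.C3 (M.t (M.σ p)) ∨
        M.kind (M.t (M.σ p)) = .A ∧ M.C3 (M.t (M.σ (M.σ p))))} := by
  have h1 := card_A_le (M := M) u
  have h2 := card_good_le (M := M) u hu
  have h3 := card_C3_le (M := M) u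
  have split : ∀ P Q : X → Prop, #{p | M.s p = u ∧ P p} =
      #{p | M.s p = u ∧ P p ∧ Q p} + #{p | M.s p = u ∧ P p ∧ ¬ Q p} := by
    intro P Q
    rw [← card_filter_add_card_filter_not Q, filter_filter, filter_filter]
    simp only [and_assoc]
  have h4 := split (fun p => M.C2 (M.t p)) M.Good
  have h5 := split (fun p => M.C2 (M.t p)) M.mirror.Good
  have h6 : #{x | M.s x = u ∧ (M.kind (M.t x) = .D ∨ M.C2 (M.t x))} =
      #{x | M.s x = u ∧ M.kind (M.t x) = .D} + #{x | M.s x = u ∧ M.C2 (M.t x)} := by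
    rw [← card_union_of_disjoint, ← filter_or]
    · simp only [and_or_left]
    · rw [disjoint_filter]
      intro x _ h h'
      rw [h'.2.1] at h
      simp at h
  have h7 : #{x | M.s x = u ∧ M.kind (M.t x) ≠ .A} =
      #{x | M.s x = u ∧ (M.kind (M.t x) = .D ∨ M.C2 (M.t x))} +
      #{x | M.s x = u ∧ M.C3 (M.t x)} := by
    rw [← card_union_of_disjoint, ← filter_or]
    · congr 1
      ext x
      rw [mem_filter_univ, mem_filter_univ, ← and_or_left, or_assoc, ← C_iff]
      cases M.kind (M.t x) <;> simp
    · rw [disjoint_filter]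
      rintro x _ ⟨-, h | h⟩ h'
      · rw [h'.2.1] at h
        simp at h
      · exact not_C2_of_C3 h'.2 h
  have h8 : M.deg u = #{x | M.s x = u ∧ M.kind (M.t x) = .A} +
      #{x | M.s x = u ∧ M.kind (M.t x) ≠ .A} := by
    rw [deg, ← card_filter_add_card_filter_not (fun x => M.kind (M.t x) = .A), filter_filter,
      filter_filter]
  -- With `d` darts to `D`, `c` to `C2`, `c'` to `C3`, `g` good sides and `e` defects, the claim is
  -- `S = d + c + e - g ≥ 6`. From `g ≤ d` and `g ≤ 2c` follows `2S ≥ d`, which settles `d ≥ 11`.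
  -- Otherwise `c' ≤ S` and `g ≤ d ≤ 2S` give `41 ≤ deg u ≤ 4S + 2g ≤ 8S`.
  have h9 : 11 ≤ #{x | M.s x = u ∧ M.kind (M.t x) = .D} ∨ 41 ≤ M.deg u := M.deg_D u hu
  omega

end ColouredMap

/-! ### The global count -/

namespace ColouredMap

variable {V X F : Type*} [Fintype V] [Fintype X] [Fintype F] {M : ColouredMap V X F}

lemma sum_face_add (M : ColouredMap V X F) :
    ∑ f, (2 * M.len f - 6) + 6 * Fintype.card F = 2 * Fintype.card X := by
  have h : ∑ f, (2 * M.len f - 6) + ∑ _f : F, 6 = ∑ f, 2 * M.len f := by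
    rw [← sum_add_distrib]
    refine sum_congr rfl fun f _ => ?_
    have : 3 ≤ M.len f := M.three_le_face f
    omega
  rw [← mul_sum, sum_len, sum_const, card_univ, smul_eq_mul] at h
  omega

lemma card_filter_eq_sum (P : V → Prop) (Q : X → Prop) [DecidablePred P] [DecidablePred Q] :
    #{x | P (M.s x) ∧ Q x} = ∑ v with P v, #{x | M.s x = v ∧ Q x} := by
  rw [card_eq_sum_card_fiberwise (f := M.s) (t := ({v | P v} : Finset V))]
  · refine sum_congr rfl fun v hv => ?_
    rw [mem_filter_univ] at hv
    rw [filter_filter]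
    congr 1
    ext x
    simp only [mem_filter_univ]
    constructor
    · rintro ⟨⟨-, h⟩, h'⟩
      exact ⟨h', h⟩
    · rintro ⟨rfl, h⟩
      exact ⟨⟨hv, h⟩, rfl⟩
  · intro x hx
    rw [mem_coe, mem_filter_univ] at hx ⊢
    exact hx.1

lemma card_r (P Q : V → Prop) [DecidablePred P] [DecidablePred Q] :
    #{x | P (M.s x) ∧ Q (M.t x)} = #{x | Q (M.s x) ∧ P (M.t x)} := by
  refine card_bij (fun x _ => M.r x) ?_ ?_ ?_
  · intro x hx
    rw [mem_filter_univ] at hx ⊢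
    rw [t_r]
    exact hx.symm
  · intro x _ y _ e
    exact M.r_inj e
  · intro x hx
    rw [mem_filter_univ] at hx
    refine ⟨M.r x, ?_, M.r_r x⟩
    rw [mem_filter_univ, t_r]
    exact hx.symm

lemma card_V : Fintype.card V = #{v | M.kind v = .A} + #{v | M.kind v = .C} +
    #{v | M.kind v = .D} := by
  rw [← card_univ, card_eq_sum_ones, card_filter, card_filter, card_filter, ← sum_add_distrib,
    ← sum_add_distrib]
  refine sum_congr rfl fun v _ => ?_
  cases M.kind v <;> simp

lemma card_X : Fintype.card X = 2 * #{x | M.kind (M.s x) = .A} +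
    2 * #{x | M.kind (M.s x) = .C ∧ M.kind (M.t x) = .D} +
    #{x | M.kind (M.s x) = .C ∧ M.kind (M.t x) = .C} +
    #{x | M.kind (M.s x) = .D ∧ M.kind (M.t x) = .D} := by
  have h1 := card_r (M := M) (fun v => M.kind v = .A) (fun _ => True)
  have h2 := card_r (M := M) (fun v => M.kind v = .C) (fun v => M.kind v = .D)
  rw [two_mul, two_mul]
  simp only [true_and, and_true] at h1
  nth_rw 2 [h1, h2]
  rw [← card_univ, card_eq_sum_ones]
  simp only [card_filter, ← sum_add_distrib]
  refine sum_congr rfl fun x _ => ?_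
  have := M.indep x
  change _ → M.kind (M.t x) ≠ .A at this
  cases hs : M.kind (M.s x) <;> cases ht : M.kind (M.t x) <;> simp_all

lemma sum_A_add (M : ColouredMap V X F) :
    ∑ v with M.kind v = .A, (2 * M.deg v - 6) + 6 * #{v | M.kind v = .A} =
      2 * #{x | M.kind (M.s x) = .A} := by
  have h := card_filter_eq_sum (M := M) (fun v => M.kind v = .A) (fun _ => True)
  simp only [and_true] at h
  rw [h, mul_sum, card_eq_sum_ones, mul_sum, ← sum_add_distrib]
  refine sum_congr rfl fun v hv => ?_
  rw [mem_filter_univ] at hv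
  have := M.three_le_deg' hv
  unfold deg at this ⊢
  omega

/-- Three darts to `D` already give `2 * 3 = 6`; a `C2`-vertex gets `2 * 2` and one more unit from
each of the two darts arriving from `D`. -/
lemma six_mul_card_C_le :
    6 * #{v | M.kind v = .C} ≤ 2 * #{x | M.kind (M.s x) = .C ∧ M.kind (M.t x) = .D} +
      #{x | M.kind (M.s x) = .D ∧ M.C2 (M.t x)} := by
  rw [card_r (fun v => M.kind v = .D) (fun v => M.C2 v),
    card_filter_eq_sum (fun v => M.kind v = .C) (fun x => M.kind (M.t x) = .D),
    card_filter_eq_sum (fun v => M.C2 v) (fun x => M.kind (M.t x) = .D)]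
  have h : ∑ v with M.C2 v, #{x | M.s x = v ∧ M.kind (M.t x) = .D} =
      ∑ v with M.kind v = .C, if M.C2 v then 2 else 0 := by
    rw [← sum_filter, filter_filter]
    refine sum_congr ?_ fun v hv => ?_
    · ext v
      simp only [mem_filter_univ]
      exact ⟨fun h => ⟨h.1, h⟩, fun h => h.2⟩
    · rw [mem_filter_univ] at hv
      exact hv.2.2
  rw [h, card_eq_sum_ones, mul_sum, mul_sum, ← sum_add_distrib]
  refine sum_le_sum fun v hv => ?_
  rw [mem_filter_univ] at hv
  have h2 := two_le_card_toD hv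
  split_ifs with hC
  · omega
  · have : #{x | M.s x = v ∧ M.kind (M.t x) = .D} ≠ 2 := fun e => hC ⟨hv, e⟩
    omega

lemma sum_charge_le (M : ColouredMap V X F) :
    6 * #{v | M.kind v = .D} + #{x | M.kind (M.s x) = .D ∧ M.C2 (M.t x)} ≤
      #{x | M.kind (M.s x) = .D ∧ M.kind (M.t x) = .D} +
      #{p | M.kind (M.s p) = .D ∧ M.C2 (M.t p) ∧ ¬ M.Good p} +
      #{p | M.kind (M.s p) = .D ∧ M.C2 (M.t p) ∧ ¬ M.mirror.Good p} +
      #{p | M.kind (M.s p) = .D ∧ M.kind (M.t p) = .A ∧ M.kind (M.t (M.σ p)) = .A} +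
      #{p | M.kind (M.s p) = .D ∧ M.C3 (M.t p) ∧ (M.C3 (M.t (M.σ p)) ∨
        M.kind (M.t (M.σ p)) = .A ∧ M.C3 (M.t (M.σ (M.σ p))))} := by
  have h := fun (Q : X → Prop) [DecidablePred Q] =>
    card_filter_eq_sum (M := M) (fun v => M.kind v = .D) Q
  rw [h (fun x => M.C2 (M.t x)), h (fun x => M.kind (M.t x) = .D),
    h (fun p => M.C2 (M.t p) ∧ ¬ M.Good p), h (fun p => M.C2 (M.t p) ∧ ¬ M.mirror.Good p),
    h (fun p => M.kind (M.t p) = .A ∧ M.kind (M.t (M.σ p)) = .A),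
    h (fun p => M.C3 (M.t p) ∧ (M.C3 (M.t (M.σ p)) ∨
        M.kind (M.t (M.σ p)) = .A ∧ M.C3 (M.t (M.σ (M.σ p))))),
    card_eq_sum_ones, mul_sum, ← sum_add_distrib, ← sum_add_distrib, ← sum_add_distrib,
    ← sum_add_distrib, ← sum_add_distrib]
  refine sum_le_sum fun u hu => ?_
  rw [mem_filter_univ] at hu
  exact charge_le u hu

lemma Saturated.false (hM : M.Saturated) : False := by
  have h1 := M.sum_charge_le
  have h2 := hM.card_bad_le
  -- The other side of the bad darts is handled in the mirror image.
  have h3 : #{p | M.kind (M.s p) = .D ∧ M.C2 (M.t p) ∧ ¬ M.Good p} ≤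
      #{b | M.kind (M.s b) = .A ∧ 4 ≤ M.deg (M.s b) ∧ M.C2 (M.t b) ∧
        M.kind (M.t (M.σ.symm b)) = .D} +
      #{h | M.C2 (M.s h) ∧ M.kind (M.t h) = .C ∧ M.Good h} := hM.mirror.card_bad_le
  have h4 := hM.card_events_le
  have h5 := hM.card_le_sum_A
  have h6 := card_CC_ge (M := M)
  have h7 := M.sum_face_add
  have h8 := M.sum_A_add
  have h9 := six_mul_card_C_le (M := M)
  have h10 := card_V (M := M)
  have h11 := card_X (M := M)
  have h12 := M.euler
  omega

end ColouredMap

/-! ### From plane embeddings to coloured maps -/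

namespace Graph

variable {α β F : Type*} {H : Graph α β}

/-- The reverse of a dart. -/
noncomputable def Dart.rev (d : H.Dart) : H.Dart := ⟨d.edge, d.inc.other, d.inc.inc_other⟩

lemma Dart.isLink (d : H.Dart) : H.IsLink d.edge d.vertex d.rev.vertex := d.inc.isLink_other

lemma Dart.rev_rev (d : H.Dart) : d.rev.rev = d := by
  ext
  · rfl
  · exact d.rev.isLink.right_unique d.isLink.symm

lemma Dart.rev_vertex_ne (hH : H.Loopless) (d : H.Dart) : d.rev.vertex ≠ d.vertex :=
  d.isLink.ne.symm

lemma Dart.eq_or_eq_rev {d d' : H.Dart} (h : d.edge = d'.edge) : d' = d ∨ d' = d.rev := by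
  have := d.isLink
  rw [h] at this
  refine (d'.inc.eq_or_eq_of_isLink this).imp (fun h' => ?_) (fun h' => ?_)
  · exact Dart.ext h.symm h'
  · exact Dart.ext h.symm h'

lemma finite_dart (hV : H.vertexSet.Finite) (hE : H.edgeSet.Finite) : Finite H.Dart := by
  have := hV.to_subtype
  have := hE.to_subtype
  refine Finite.of_injective
    (fun d : H.Dart => ((⟨d.edge, d.inc.edge_mem⟩, ⟨d.vertex, d.inc.vertex_mem⟩) :
      H.edgeSet × H.vertexSet)) fun d d' h => ?_
  simp only [Prod.mk.injEq, Subtype.mk.injEq] at h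
  exact Dart.ext h.1 h.2

/-- An upper bound is enough, since Euler's formula is only used as an inequality. -/
lemma card_dart_le [Fintype H.Dart] (hE : H.edgeSet.Finite) :
    Fintype.card H.Dart ≤ 2 * H.edgeSet.ncard := by
  have h := card_le_mul_card_image (f := Dart.edge) (univ : Finset H.Dart) 2 (by
    intro e he
    obtain ⟨d, -, rfl⟩ := mem_image.1 he
    refine (card_le_card (t := {d, d.rev}) fun d' hd' => ?_).trans card_le_two
    rw [mem_filter_univ] at hd'
    rw [mem_insert, mem_singleton]
    exact Dart.eq_or_eq_rev hd'.symm)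
  rw [card_univ] at h
  refine h.trans (Nat.mul_le_mul_left _ ?_)
  rw [← Set.ncard_coe_finset]
  refine Set.ncard_le_ncard ?_ hE
  intro e he
  obtain ⟨d, -, rfl⟩ := mem_image.1 (mem_coe.1 he)
  exact d.inc.edge_mem

lemma card_edges_eq [Fintype H.Dart] (u : α) (S : Set β) (P : H.Dart → Prop)
    (h : ∀ e, e ∈ S ↔ ∃ d : H.Dart, d.edge = e ∧ d.vertex = u ∧ P d) :
    S.ncard = #{d : H.Dart | d.vertex = u ∧ P d} := by
  rw [← Set.ncard_coe_finset, ← Set.InjOn.ncard_image (f := Dart.edge)]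
  · congr 1
    ext e
    rw [h, Set.mem_image]
    refine exists_congr fun d => ?_
    rw [mem_coe, mem_filter_univ]
    tauto
  · intro d hd d' hd' e
    rw [mem_coe, mem_filter_univ] at hd hd'
    exact Dart.ext e (hd.1.trans hd'.1.symm)

lemma degree_eq [Fintype H.Dart] (u : α) : H.degree u = #{d : H.Dart | d.vertex = u} := by
  have := card_edges_eq (H := H) u (H.incidenceSet u) (fun _ => True) (fun e => ?_)
  · simpa [degree] using this
  · rw [mem_incidenceSet]
    constructor
    · exact fun h => ⟨⟨e, u, h⟩, rfl, rfl, trivial⟩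
    · rintro ⟨d, rfl, rfl, -⟩
      exact d.inc

lemma degree_induce_eq [Fintype H.Dart] {D : Set α} {u : α} (hu : u ∈ D) :
    (H.induce D).degree u = #{d : H.Dart | d.vertex = u ∧ d.rev.vertex ∈ D} := by
  refine card_edges_eq u _ (fun d => d.rev.vertex ∈ D) (fun e => ?_)
  rw [mem_incidenceSet]
  constructor
  · rintro ⟨y, hl, -, hy⟩
    refine ⟨⟨e, u, hl.inc_left⟩, rfl, rfl, ?_⟩
    rwa [(Dart.isLink ⟨e, u, hl.inc_left⟩).right_unique hl]
  · rintro ⟨d, rfl, rfl, hd⟩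
    exact ⟨_, d.isLink, hu, hd⟩

lemma mem_neighborhood_iff {v w : α} :
    w ∈ H.neighborhood v ↔ ∃ d : H.Dart, d.vertex = v ∧ d.rev.vertex = w := by
  constructor
  · rintro ⟨e, he⟩
    exact ⟨⟨e, v, he.inc_left⟩, rfl, (Dart.isLink ⟨e, v, he.inc_left⟩).right_unique he⟩
  · rintro ⟨d, rfl, rfl⟩
    exact ⟨_, d.isLink⟩

/-- The class of a vertex. -/
noncomputable def vertexKind (A C : Set α) (v : α) : VertexKind :=
  if v ∈ A then .A else if v ∈ C then .C else .D

section

variable {A C D : Set α} {v : α}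

lemma vertexKind_eq_A : vertexKind A C v = .A ↔ v ∈ A := by
  unfold vertexKind
  split_ifs <;> simp_all

lemma vertexKind_eq_C (h : Disjoint A C) : vertexKind A C v = .C ↔ v ∈ C := by
  have : v ∈ C → v ∉ A := fun h' => Set.disjoint_right.1 h h'
  unfold vertexKind
  split_ifs <;> simp_all

lemma vertexKind_eq_D (hAD : Disjoint A D) (hCD : Disjoint C D) (hv : v ∈ A ∪ C ∪ D) :
    vertexKind A C v = .D ↔ v ∈ D := by
  have : v ∈ D → v ∉ A := fun h' => Set.disjoint_right.1 hAD h'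
  have : v ∈ D → v ∉ C := fun h' => Set.disjoint_right.1 hCD h'
  unfold vertexKind
  split_ifs <;> simp_all

end

/-- The dart structure of a plane embedding satisfying the hypotheses of the theorem, but not its
conclusion. -/
noncomputable def PlaneEmbedding.toColouredMap [Fintype H.vertexSet] [Fintype H.Dart] [Fintype F]
    (hEfin : H.edgeSet.Finite) (hloop : H.Loopless)
    (M : H.PlaneEmbedding F) (hM : M.IsPlaneMap)
    (A C D : Set α) (hAC : Disjoint A C) (hAD : Disjoint A D) (hCD : Disjoint C D)
    (hV : H.vertexSet = A ∪ C ∪ D)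
    (hC : ∀ v ∈ C, 2 ≤ (H.neighborhood v ∩ D).ncard)
    (hCpair : ∀ v₁ ∈ C, ∀ v₂ ∈ C, v₁ ≠ v₂ →
      (H.neighborhood v₁ ∩ D).ncard = 2 → (H.neighborhood v₂ ∩ D).ncard = 2 →
      H.neighborhood v₁ ∩ D ≠ H.neighborhood v₂ ∩ D)
    (hA : H.IsIndependent A) (hAdeg : ∀ v ∈ A, 3 ≤ H.degree v)
    (hD : ∀ u ∈ D, 11 ≤ (H.induce D).degree u ∨ 41 ≤ H.degree u) :
    ColouredMap H.vertexSet H.Dart F :=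
  have kD : ∀ v : H.vertexSet, vertexKind A C v = .D ↔ (v : α) ∈ D := fun v =>
    vertexKind_eq_D hAD hCD (hV ▸ v.2)
  have hmem : ∀ d : H.Dart, d.vertex ∈ H.vertexSet := fun d => d.inc.vertex_mem
  have hnbr : ∀ v : H.vertexSet, Subtype.val '' {w : H.vertexSet | vertexKind A C w = .D ∧
      ∃ d : H.Dart, (⟨d.vertex, hmem d⟩ : H.vertexSet) = v ∧
        (⟨d.rev.vertex, hmem d.rev⟩ : H.vertexSet) = w} = H.neighborhood v ∩ D := by
    intro v
    ext w
    rw [Set.mem_image, Set.mem_inter_iff, mem_neighborhood_iff]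
    constructor
    · rintro ⟨w, ⟨hw, d, hd, hd'⟩, rfl⟩
      exact ⟨⟨d, congrArg Subtype.val hd, congrArg Subtype.val hd'⟩, (kD w).1 hw⟩
    · rintro ⟨⟨d, hd, rfl⟩, hw⟩
      exact ⟨⟨_, hmem d.rev⟩, ⟨(kD _).2 hw, d, Subtype.ext hd, rfl⟩, rfl⟩
  have hcard : ∀ v : H.vertexSet, #{w : H.vertexSet | vertexKind A C w = .D ∧
      ∃ d : H.Dart, (⟨d.vertex, hmem d⟩ : H.vertexSet) = v ∧
        (⟨d.rev.vertex, hmem d.rev⟩ : H.vertexSet) = w} = (H.neighborhood v ∩ D).ncard := by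
    intro v
    rw [← hnbr, Set.ncard_image_of_injective _ Subtype.val_injective, ← Set.ncard_coe_finset,
      coe_filter_univ]
  { kind := fun v => vertexKind A C v
    σ := M.rot
    r := Dart.rev
    s := fun d => ⟨d.vertex, hmem d⟩
    face := M.face
    r_r := Dart.rev_rev
    s_r := fun d h => Dart.rev_vertex_ne hloop d (congrArg Subtype.val h)
    s_σ := fun d => Subtype.ext (M.rot_vertex d)
    sameCycle := fun d d' h => M.rot_sameCycle d d' (congrArg Subtype.val h)
    face_σ_r := fun d => M.face_rot d d.rev rfl (Dart.rev_vertex_ne hloop d).symm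
    three_le_face := fun f => by
      have := hM f
      rw [faceLength, Nat.card_eq_fintype_card, Fintype.card_subtype] at this
      exact this
    -- The number of components is discarded: only `|V| - |E| + |F| ≥ 1` is kept.
    euler := by
      have h := M.genus_zero
      have h' := card_dart_le hEfin
      rw [Nat.card_eq_fintype_card, ← Nat.card_coe_set_eq, Nat.card_eq_fintype_card] at h
      omega
    indep := fun d h h' => hA _ (vertexKind_eq_A.1 h) _ (vertexKind_eq_A.1 h') ⟨_, d.isLink⟩
    three_le_deg := fun v hv => by
      have := hAdeg v (vertexKind_eq_A.1 hv)
      rw [degree_eq] at this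
      simpa only [Subtype.ext_iff] using this
    two_le_nbr := fun v hv => by
      have h := hC v ((vertexKind_eq_C hAC).1 hv)
      rw [← hcard] at h
      convert h
    nbr_inj := fun v₁ v₂ h₁ h₂ h h' => by
      have h : (H.neighborhood v₁ ∩ D).ncard = 2 := by
        rw [← hcard]
        convert h
      have e : H.neighborhood v₁ ∩ D = H.neighborhood v₂ ∩ D := by
        rw [← hnbr v₁, ← hnbr v₂, h']
      by_contra hne
      exact hCpair v₁ ((vertexKind_eq_C hAC).1 h₁) v₂ ((vertexKind_eq_C hAC).1 h₂)
        (fun h => hne (Subtype.ext h)) h (e ▸ h) e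
    deg_D := fun u hu => by
      have hu' := (kD u).1 hu
      have := hD u hu'
      rw [degree_induce_eq hu', degree_eq] at this
      simpa only [Subtype.ext_iff, fun d : H.Dart => kD ⟨d.rev.vertex, hmem d.rev⟩] using this }

end Graph

end

theorem lemma3p4 {α β F : Type*} (H : Graph α β) (hVfin : H.vertexSet.Finite)
    (hEfin : H.edgeSet.Finite) (hloop : H.Loopless)
    (M : H.PlaneEmbedding F) (hM : M.IsPlaneMap)
    (A C D : Set α) (hAC : Disjoint A C) (hAD : Disjoint A D) (hCD : Disjoint C D)
    (hV : H.vertexSet = A ∪ C ∪ D)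
    (hC : ∀ v ∈ C, 2 ≤ (H.neighborhood v ∩ D).ncard)
    (hCpair : ∀ v₁ ∈ C, ∀ v₂ ∈ C, v₁ ≠ v₂ →
      (H.neighborhood v₁ ∩ D).ncard = 2 → (H.neighborhood v₂ ∩ D).ncard = 2 →
      H.neighborhood v₁ ∩ D ≠ H.neighborhood v₂ ∩ D)
    (hA : H.IsIndependent A) (hAdeg : ∀ v ∈ A, 3 ≤ H.degree v) :
    ∃ u ∈ D, (H.induce D).degree u ≤ 10 ∧ H.degree u ≤ 40 := by
  by_contra hcon
  have hD : ∀ u ∈ D, 11 ≤ (H.induce D).degree u ∨ 41 ≤ H.degree u := by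
    intro u hu
    by_contra h
    exact hcon ⟨u, hu, by omega, by omega⟩
  have := hVfin.fintype
  have := Graph.finite_dart hVfin hEfin
  have := Fintype.ofFinite H.Dart
  have := M.finite_face
  have := Fintype.ofFinite F
  exact ColouredMap.false_of_saturated (fun X F _ _ M hM => hM.false) _ _
    (M.toColouredMap hEfin hloop hM A C D hAC hAD hCD hV hC hCpair hA hAdeg hD)
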